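/- Let $\mathcal H$ be an infinite-dimensional separable complex Hilbert space and $\mathcal L_{\mathcal H}$ its bounded linear operators. **Definitions.** The cross-covariance function of square-integrable $\mathcal H$-valued random variables $Z,U$ is $c_{Z,U}(v,w)=\operatorname E\big(\langle v,Z-\operatorname EZ\rangle\overline{\langle w,U-\operatorname EU\rangle}\big)$. A process $(\varepsilon_t)_{t\in\mathbb Z}$ is *white noise* if $0<\operatorname E\|\varepsilon_t\|^2<\infty$, $\operatorname E\varepsilon_t=0$, the covariance operator of $\varepsilon_t$ does not depend on $t$, and $c_{\varepsilon_t,\varepsilon_s}=0$ for $s\ne t$. A process $u_t$ in a Hilbert space is a *linear process* if $u_t-\operatorname E u_t=\sum_{n\ge0}B_n\varepsilon_{t-n}$ for some white noise $\varepsilon_t$ in that space and bounded operators $B_n$ with $B_0=I$ and $\sum_n\|B_n\||z|^n<\infty$ on a disc $|z|<\rho$, $\rho>1$; it is $I(0)$ if it has such a representation with $\sum_n B_n\ne0$. With $\Delta z_t=z_t-z_{t-1}$, $z_t\sim I(d)$ means that $\Delta^d z_t$ is $I(0)$. For an $I(d)$ process $z_t$ the *cointegrating space* is $\{v:\langle v,z_t\rangle\sim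 I(b)\text{ for some }0\le b<d\}\cup\{0\}$ (the scalar process $\langle v,z_t\rangle$ being regarded as a process in the Hilbert space $\mathbb C$); $z_t$ is *cointegrated* if this set contains a nonzero vector; its orthogonal complement is the *attractor space*. Let $A(z)=I-\sum_{h=1}^kA^\circ_hz^h$ with $A_h^\circ\in\mathcal L_{\mathcal H}$ and $A(1)\neq0$ have a *unit root of finite type*: $A(1)$ is Fredholm (closed range, finite-dimensional kernel, finite-codimensional range), $A(1)v=0$ for some $v\ne0$, and $A(z)$ is invertible for all $z\ne1$ with $|z|<\rho$, for some $\rho>1$. Let $\varepsilon_t$ be white noise in $\mathcal H$ and let $x_t$, $t\in\mathbb Z$, be a square-integrable solution of $$x_t=A^\circ_1x_{t-1}+\dots+A^\circ_kx_{t-k}+\varepsilon_t,\qquad t\in\mathbb Z,$$ with no exponentially explosive component in the past, i.e. for every $r>1$ one has $\operatorname E\|x_{-n}\|^2=O(r^{n})$ as $n\to\infty$. **Corollary (Cointegration properties).** There are an integer $d\ge1$ and operators $C_n\in\mathcal L_{\mathcal H}$, $n\geq 0$, $C_0\ne0$, such that $A(z)^{-1}=\sum_{n\ge0}C_n(1-z)^{n-d}$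 in a punctured disc around $z=1$, and: (i) $x_t\sim I(d)$; moreover $\operatorname{Im}C_0$ is finite-dimensional and $(\operatorname{Im}C_0)^\perp$ is infinite-dimensional. If in addition the covariance operator of $\varepsilon_t$ is positive definite, i.e. $\operatorname E|\langle v,\varepsilon_0\rangle|^2>0$ for all $v\ne0$, then: (ii) $x_t$ is cointegrated; (iii) $\operatorname{Im}C_0$ is the attractor space of $x_t$; (iv) $(\operatorname{Im}C_0)^\perp$ is the cointegrating space of $x_t$. -/

import Mathlib

open MeasureTheory

noncomputable section

/-! ### Hilbert space valued random variables and processes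

Processes are indexed by `ℤ`; a process in `E` is a map `ℤ → Ω → E`. -/

section Processes

variable {Ω E : Type*} [MeasurableSpace Ω] [NormedAddCommGroup E] [InnerProductSpace ℂ E]

/-- Cross-covariance function `(v, w) ↦ E (⟨v, Z - E Z⟩ * conj ⟨w, U - E U⟩)` of two random
variables in a complex Hilbert space (`inner ℂ` is linear in its second argument). -/
def crossCov (P : Measure Ω) (Z U : Ω → E) (v w : E) : ℂ :=
  ∫ ω, inner ℂ v (Z ω - ∫ ω', Z ω' ∂P) * inner ℂ (U ω - ∫ ω', U ω' ∂P) w ∂P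

/-- Covariance operator `w ↦ E (⟨Z, w⟩ Z)`. -/
def covOperator (P : Measure Ω) (Z : Ω → E) (w : E) : E :=
  ∫ ω, (inner ℂ (Z ω) w : ℂ) • Z ω ∂P

/-- Weakly stationary process. -/
structure IsWeaklyStationary [MeasurableSpace E] (P : Measure Ω) (ε : ℤ → Ω → E) : Prop where
  measurable : ∀ t, Measurable (ε t)
  memLp : ∀ t, MemLp (ε t) 2 P
  pos : ∀ t, 0 < ∫ ω, ‖ε t ω‖ ^ 2 ∂P
  mean_eq : ∀ s t, ∫ ω, ε s ω ∂P = ∫ ω, ε t ω ∂P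
  covOperator_eq : ∀ s t, covOperator P (ε s) = covOperator P (ε t)
  crossCov_shift : ∀ s t u : ℤ, ∀ v w : E,
    crossCov P (ε t) (ε s) v w = crossCov P (ε (t + u)) (ε (s + u)) v w

/-- White noise. -/
structure IsWhiteNoise [MeasurableSpace E] (P : Measure Ω) (ε : ℤ → Ω → E) : Prop
    extends IsWeaklyStationary P ε where
  mean_zero : ∀ t, ∫ ω, ε t ω ∂P = 0
  crossCov_zero : ∀ s t : ℤ, s ≠ t → ∀ v w : E, crossCov P (ε t) (ε s) v w = 0

/-- `u` is the linear process `u_t - E u_t = ∑_{n ≥ 0} B_n ε_{t-n}` driven by the white noise `ε`,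
with `B_0 = I` and `∑ B_n z ^ n` absolutely convergent on a disc of radius larger than one. -/
structure IsLinearProcessWith [MeasurableSpace E] (P : Measure Ω) (ε : ℤ → Ω → E)
    (B : ℕ → E →L[ℂ] E) (u : ℤ → Ω → E) : Prop where
  whiteNoise : IsWhiteNoise P ε
  measurable : ∀ t, Measurable (u t)
  integrable : ∀ t, Integrable (u t) P
  coeff_zero : B 0 = ContinuousLinearMap.id ℂ E
  abs_convergent : ∃ ρ : ℝ, 1 < ρ ∧ ∀ z : ℂ, ‖z‖ < ρ → Summable fun n => ‖B n‖ * ‖z‖ ^ n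
  eq_series : ∀ t : ℤ, ∀ᵐ ω ∂P,
    HasSum (fun n : ℕ => B n (ε (t - n) ω)) (u t ω - ∫ ω', u t ω' ∂P)

/-- Integrated of order zero: a linear process with `B(1) ≠ 0`. -/
def IsIntegratedZero [MeasurableSpace E] (P : Measure Ω) (u : ℤ → Ω → E) : Prop :=
  ∃ (ε : ℤ → Ω → E) (B : ℕ → E →L[ℂ] E), IsLinearProcessWith P ε B u ∧ ∑' n, B n ≠ 0

/-- The difference operator `Δ = 1 - L`. -/
def diffOp (u : ℤ → Ω → E) : ℤ → Ω → E := fun t ω => u t ω - u (t - 1) ω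

/-- `z ∼ I(d)`: the `d`-th difference of `z` is integrated of order zero. -/
def IsIntegrated [MeasurableSpace E] (P : Measure Ω) (d : ℕ) (z : ℤ → Ω → E) : Prop :=
  IsIntegratedZero P (diffOp^[d] z)

/-- The `v`-characteristic `⟨v, z_t⟩`, a scalar process. -/
def characteristic (v : E) (z : ℤ → Ω → E) : ℤ → Ω → ℂ := fun t ω => inner ℂ v (z t ω)

/-- The `I(d)` process `z` is cointegrated. -/
def IsCointegrated [MeasurableSpace E] (P : Measure Ω) (d : ℕ) (z : ℤ → Ω → E) : Prop :=
  IsIntegrated P d z ∧ ∃ v : E, v ≠ 0 ∧ ∃ b < d, IsIntegrated P b (characteristic v z)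

/-- The cointegrating space of an `I(d)` process. -/
def cointegratingSpace (P : Measure Ω) (d : ℕ) (z : ℤ → Ω → E) : Set E :=
  {v | ∃ b < d, IsIntegrated P b (characteristic v z)} ∪ {0}

/-- The attractor space: the orthogonal complement of the cointegrating space. -/
def attractorSpace (P : Measure Ω) (d : ℕ) (z : ℤ → Ω → E) : Set E :=
  {u | ∀ v ∈ cointegratingSpace P d z, inner ℂ v u = 0}

end Processes

/-! ### Autoregressions -/

section AR

variable {H : Type*} [NormedAddCommGroup H] [InnerProductSpace ℂ H]

/-- `A(z) = I - ∑_{h=1}^k A°_h z^h`; the operator `A°_h` is `a i` with `h = i + 1`. -/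
def arPoly {k : ℕ} (a : Fin k → H →L[ℂ] H) (z : ℂ) : H →L[ℂ] H :=
  ContinuousLinearMap.id ℂ H - ∑ i : Fin k, z ^ ((i : ℕ) + 1) • a i

/-- `z₀` is an eigenvalue of finite type of the operator function `W`. -/
structure IsEigenvalueOfFiniteType (W : ℂ → H →L[ℂ] H) (z₀ : ℂ) : Prop where
  fredholm : (W z₀).IsFredholm
  exists_eigenvector : ∃ v : H, v ≠ 0 ∧ W z₀ v = 0
  isolated : ∃ δ : ℝ, 0 < δ ∧ ∀ z : ℂ, z ≠ z₀ → ‖z - z₀‖ < δ → IsUnit (W z)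

/-- The autoregressive operator function has a unit root of finite type (at `z = 1`). -/
structure HasUnitRootOfFiniteType {k : ℕ} (a : Fin k → H →L[ℂ] H) : Prop where
  ne_zero : arPoly a 1 ≠ 0
  eigenvalue : IsEigenvalueOfFiniteType (arPoly a) 1
  invertible : ∃ ρ : ℝ, 1 < ρ ∧ ∀ z : ℂ, ‖z‖ < ρ → z ≠ 1 → IsUnit (arPoly a z)

/-- `A(z)⁻¹ = ∑_{n ≥ 0} C_n (1 - z)^(n - d)` with `C_0 ≠ 0` on a punctured disc around `1`:
`A(z)⁻¹` has a pole of order `d` at `1`, with leading coefficient `C_0`. -/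
def IsInverseLaurentExpansion {k : ℕ} (a : Fin k → H →L[ℂ] H) (d : ℕ) (C : ℕ → H →L[ℂ] H) :
    Prop :=
  C 0 ≠ 0 ∧ ∃ δ : ℝ, 0 < δ ∧ ∀ z : ℂ, z ≠ 1 → ‖z - 1‖ < δ →
    HasSum (fun n : ℕ => (1 - z) ^ ((n : ℤ) - (d : ℤ)) • C n) (Ring.inverse (arPoly a z))

/-- `x` is a square integrable solution of
`x_t = A°_1 x_{t-1} + ⋯ + A°_k x_{t-k} + ε_t`, `t ∈ ℤ`. -/
structure IsARSolution {Ω : Type*} [MeasurableSpace Ω] [MeasurableSpace H] (P : Measure Ω)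
    {k : ℕ} (a : Fin k → H →L[ℂ] H) (ε x : ℤ → Ω → H) : Prop where
  measurable : ∀ t, Measurable (x t)
  memLp : ∀ t, MemLp (x t) 2 P
  eq : ∀ t : ℤ, ∀ᵐ ω ∂P, x t ω = ∑ i : Fin k, a i (x (t - ((i : ℕ) + 1 : ℤ)) ω) + ε t ω

/-- `E ‖x_t‖²` grows slower than every exponential as `t → -∞`. This excludes the solutions that
contain an exponentially explosive solution of the homogeneous equation. -/
def IsSubexponential {Ω : Type*} [MeasurableSpace Ω] (P : Measure Ω) (x : ℤ → Ω → H) : Prop :=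
  ∀ r : ℝ, 1 < r → ∃ K : ℝ, ∀ n : ℕ, ∫ ω, ‖x (-(n : ℤ)) ω‖ ^ 2 ∂P ≤ K * r ^ n

end AR

end

/-! Everything is read off from the pole of A(z)⁻¹ at z = 1. For a nonzero operator V, the function
V A(z)⁻¹ is meromorphic at 1, because A(1) is Fredholm, and holomorphic elsewhere on a disc of
radius larger than one. Clearing its pole, of order b say, gives a holomorphic G without zeros and
with G(z) A(z) = (1 - z)^b V (`HasUnitRootOfFiniteType.exists_regularization`). Substituting the lag
operator for z turns this identity into Δ^b V x = G(L) ε (`IsARSolution.exists_movingAverage`): the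
coefficients of G decay exponentially while x grows subexponentially towards the past, so the double
series can be rearranged. The choice V = I yields d, the property I(d) and C_0 = G(1). Since A(1)
C_0 = 0, the image of C_0 lies in the finite-dimensional kernel of A(1).

Let v ≠ 0 be orthogonal to Im C_0. Then ⟨v, A(z)⁻¹ ·⟩ has a pole of order b < d
(`regularization_exponent_lt`), and Δ^b ⟨v, x⟩ is a scalar moving average of ε whose transfer
function has no zero on the unit circle. It is driven by H-valued noise, whereas I(0) asks for
scalar white noise with leading coefficient 1. Positive definiteness bounds the spectral density
away from zero, so a Wiener-Hopf equation, solved by coercivity of a Toeplitz operator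
(`exists_wienerHopf_solution`), produces scalar innovations and an invertible moving average
(`IsWhiteNoise.isIntegratedZero_of_isFilter`).

Conversely, if ⟨v, x⟩ is I(b) with b < d, then Δ^d ⟨v, x⟩ is, after centring, the difference of an
L²-bounded process, so its long-run variance E|⟨v, C_0 ε_0⟩|² vanishes
(`IsIntegratedZero.toLpMap_eq_zero`), and positive definiteness forces v ⊥ Im C_0. The attractor
space is the double orthogonal complement of Im C_0, which is closed because it is
finite-dimensional. -/

noncomputable section

/-! ### Meromorphy of the inverse at a Fredholm point -/

section MeromorphicInverse

open Filter Topology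

/-- The inverse of a holomorphic family of endomorphisms of a finite-dimensional space is
meromorphic. -/
theorem meromorphicAt_ringInverse_of_finiteDimensional {V : Type*} [NormedAddCommGroup V]
    [NormedSpace ℂ V] [FiniteDimensional ℂ V] {T : ℂ → V →L[ℂ] V} {z₀ : ℂ}
    (hT : AnalyticAt ℂ T z₀) : MeromorphicAt (fun z => Ring.inverse (T z)) z₀ := by
  classical
  let b := Module.finBasis ℂ V
  let ψ : (V →L[ℂ] V) ≃ₐ[ℂ] Matrix (Fin (Module.finrank ℂ V)) (Fin (Module.finrank ℂ V)) ℂ :=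
    (Module.End.toContinuousLinearMap V).symm.trans (LinearMap.toMatrixAlgEquiv b)
  have hentry : ∀ i j, AnalyticAt ℂ (fun z => ψ (T z) i j) z₀ := by
    intro i j
    let L : (V →L[ℂ] V) →ₗ[ℂ] ℂ := (Matrix.entryLinearMap ℂ ℂ i j) ∘ₗ ψ.toLinearMap
    have : AnalyticAt ℂ (fun z => LinearMap.toContinuousLinearMap L (T z)) z₀ :=
      (ContinuousLinearMap.analyticAt _ _).comp hT
    exact this
  have hdet : ∀ N : ℂ → Matrix (Fin (Module.finrank ℂ V)) (Fin (Module.finrank ℂ V)) ℂ,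
      (∀ i j, AnalyticAt ℂ (fun z => N z i j) z₀) → AnalyticAt ℂ (fun z => (N z).det) z₀ := by
    intro N hN
    simp only [Matrix.det_apply]
    refine Finset.analyticAt_fun_sum _ fun σ _ => ?_
    have := Finset.analyticAt_fun_prod (𝕜 := ℂ) Finset.univ (fun i _ => hN (σ i) i)
    simp only [Units.smul_def, zsmul_eq_mul]
    exact analyticAt_const.mul this
  -- Cramer's rule in coordinates. It holds also where `T z` is singular, since both `Ring.inverse`
  -- and `det⁻¹` are then zero.
  have hinv : ∀ z, Ring.inverse (T z) = ∑ i, ∑ j,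
      ((ψ (T z)).det⁻¹ * (ψ (T z)).adjugate i j) • ψ.symm (Matrix.single i j 1) := by
    intro z
    have h1 : Ring.inverse (T z) = ψ.symm ((ψ (T z))⁻¹) := by
      rw [Matrix.nonsing_inv_eq_ringInverse]
      by_cases h : IsUnit (T z)
      · have h' : IsUnit (ψ (T z)) := h.map ψ
        apply h.mul_left_cancel
        rw [Ring.mul_inverse_cancel _ h]
        apply ψ.injective
        rw [map_mul, ψ.apply_symm_apply, Ring.mul_inverse_cancel _ h', map_one]
      · have h' : ¬ IsUnit (ψ (T z)) := fun h' => h (by simpa using h'.map ψ.symm)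
        rw [Ring.inverse_non_unit _ h, Ring.inverse_non_unit _ h', map_zero]
    rw [h1]
    conv_lhs => rw [Matrix.matrix_eq_sum_single (ψ (T z))⁻¹]
    rw [map_sum]
    refine Finset.sum_congr rfl fun i _ => ?_
    rw [map_sum]
    refine Finset.sum_congr rfl fun j _ => ?_
    rw [← map_smul, Matrix.smul_single, Matrix.inv_def]
    simp
  simp_rw [hinv]
  refine MeromorphicAt.fun_sum fun i _ => MeromorphicAt.fun_sum fun j _ => ?_
  refine MeromorphicAt.smul (MeromorphicAt.mul (hdet _ hentry).meromorphicAt.inv ?_) (.const _ _)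
  have : (fun z => (ψ (T z)).adjugate i j)
      = fun z => ((ψ (T z)).updateRow j (Pi.single i 1)).det := by
    ext z; rw [Matrix.adjugate_apply]
  rw [this]
  refine (hdet _ fun k l => ?_).meromorphicAt
  simp only [Matrix.updateRow_apply]
  split_ifs
  · exact analyticAt_const
  · exact hentry k l

theorem AnalyticAt.clm_comp' {E₁ E₂ E₃ : Type*}
    [NormedAddCommGroup E₁] [NormedSpace ℂ E₁] [NormedAddCommGroup E₂] [NormedSpace ℂ E₂]
    [NormedAddCommGroup E₃] [NormedSpace ℂ E₃]
    {L : ℂ → E₂ →L[ℂ] E₃} {R : ℂ → E₁ →L[ℂ] E₂} {z₀ : ℂ}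
    (hL : AnalyticAt ℂ L z₀) (hR : AnalyticAt ℂ R z₀) :
    AnalyticAt ℂ (fun z => (L z).comp (R z)) z₀ :=
  ((ContinuousLinearMap.compL ℂ E₁ E₂ E₃).analyticAt_bilinear (L z₀, R z₀)).comp₂ hL hR

/-- Composition on the left and on the right with holomorphic operator functions preserves
meromorphy. -/
theorem MeromorphicAt.clm_comp_comp {E₁ E₂ E₃ E₄ : Type*}
    [NormedAddCommGroup E₁] [NormedSpace ℂ E₁] [NormedAddCommGroup E₂] [NormedSpace ℂ E₂]
    [NormedAddCommGroup E₃] [NormedSpace ℂ E₃] [NormedAddCommGroup E₄] [NormedSpace ℂ E₄]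
    {L : ℂ → E₃ →L[ℂ] E₄} {T : ℂ → E₂ →L[ℂ] E₃} {R : ℂ → E₁ →L[ℂ] E₂} {z₀ : ℂ}
    (hT : MeromorphicAt T z₀) (hL : AnalyticAt ℂ L z₀) (hR : AnalyticAt ℂ R z₀) :
    MeromorphicAt (fun z => (L z).comp ((T z).comp (R z))) z₀ := by
  obtain ⟨n, hn⟩ := hT
  refine ⟨n, ?_⟩
  have h := hL.clm_comp' (hn.clm_comp' hR)
  refine h.congr (Eventually.of_forall fun z => ?_)
  simp [ContinuousLinearMap.smul_comp]

/-- The inverse of a holomorphic operator function is meromorphic at a point at which the function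
is Fredholm and near which it is invertible. -/
theorem meromorphicAt_ringInverse_of_isFredholm {H : Type*} [NormedAddCommGroup H]
    [NormedSpace ℂ H] [CompleteSpace H] {A : ℂ → H →L[ℂ] H} {z₀ : ℂ} (hA : AnalyticAt ℂ A z₀)
    (hF : (A z₀).IsFredholm) (hU : ∀ᶠ z in 𝓝[≠] z₀, IsUnit (A z)) :
    MeromorphicAt (fun z => Ring.inverse (A z)) z₀ := by
  obtain ⟨pkg⟩ := hF.nonempty_fredholmPackage
  have := pkg.decDom.finite_X₀
  have := pkg.decCodom.finite_X₀
  let M := pkg.decDom.X₀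
  let Q := pkg.decCodom.X₀
  let G : H →L[ℂ] H := pkg.quasiInverse
  let πQ : H →L[ℂ] Q := Q.projectionOntoL _ pkg.decCodom.isTopCompl.symm
  let PQ : H →L[ℂ] H := Q.subtypeL ∘L πQ
  have hA0 : ∀ y, A z₀ y = pkg.equiv (pkg.decDom.proj y) := fun y =>
    congrArg (fun T : H →L[ℂ] H => T y) pkg.eq_equiv
  have hG : ∀ y, G y = pkg.equiv.symm (pkg.decCodom.proj y) := fun y => rfl
  have hAG : ∀ y, A z₀ (G y) + PQ y = y := by
    intro y
    rw [hA0, hG, Submodule.projectionOntoL_apply_left, ContinuousLinearEquiv.apply_symm_apply]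
    exact Submodule.projection_add_projection_eq_self pkg.decCodom.isTopCompl.isCompl y
  have hGA : ∀ y, ∃ m : M, G (A z₀ y) + m = y := by
    intro y
    refine ⟨M.projectionOntoL _ pkg.decDom.isTopCompl.symm y, ?_⟩
    rw [hG, hA0, Submodule.projectionOntoL_apply_left, ContinuousLinearEquiv.symm_apply_apply]
    exact Submodule.projection_add_projection_eq_self pkg.decDom.isTopCompl.isCompl y
  have hGQ : ∀ q : Q, G q = 0 := by
    intro q
    rw [hG, Submodule.projectionOntoL_apply_right]
    simp
  have hMG : ∀ (m : M) y, (m : H) = G y → m = 0 := by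
    intro m y h
    rw [hG] at h
    have := pkg.decDom.isTopCompl.isCompl.disjoint
    rw [Submodule.disjoint_def] at this
    exact Subtype.ext (this m (h ▸ Subtype.prop _) m.2)
  have hπ : ∀ q : Q, πQ q = q := fun q => Submodule.projectionOntoL_apply_left _ q
  have hπA : ∀ y, πQ (A z₀ y) = 0 := by
    intro y
    rw [hA0]
    exact Submodule.projectionOntoL_apply_right _ _
  -- `U z` equals `A z * G + PQ`, hence is the identity at `z₀` and invertible nearby. Dividing by
  -- it makes `Y z * G` independent of `z`, so that only the block from `M` to `Q` still decides
  -- invertibility.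
  let U : ℂ → H →L[ℂ] H := fun z => 1 + (A z - A z₀) * G
  have hUan : AnalyticAt ℂ U z₀ :=
    analyticAt_const.add ((hA.sub analyticAt_const).mul analyticAt_const)
  have hU0 : U z₀ = 1 := by simp [U]
  have hUunit : ∀ᶠ z in 𝓝 z₀, IsUnit (U z) := by
    refine hUan.continuousAt.eventually_mem (Units.isOpen.mem_nhds ?_)
    rw [hU0]
    exact isUnit_one
  let Ui : ℂ → H →L[ℂ] H := fun z => Ring.inverse (U z)
  have hUi : AnalyticAt ℂ Ui z₀ := by
    have h1 : IsUnit (U z₀) := by rw [hU0]; exact isUnit_one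
    have := analyticAt_inverse (𝕜 := ℂ) h1.unit
    exact AnalyticAt.fun_comp this hUan
  let Y : ℂ → H →L[ℂ] H := fun z => Ui z * A z
  have hY : AnalyticAt ℂ Y z₀ := hUi.mul hA
  -- The Schur complement, a map between finite-dimensional spaces.
  let S : ℂ → M →L[ℂ] Q := fun z => πQ ∘L (Y z) ∘L M.subtypeL
  have hS : AnalyticAt ℂ S z₀ := analyticAt_const.clm_comp' (hY.clm_comp' analyticAt_const)
  -- `Y z` agrees with `A z₀` on the range of `G`.
  have hYG : ∀ z, IsUnit (U z) → ∀ y, Y z (G y) + PQ y = y := by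
    intro z hz y
    have e1 : ∀ w, Ui z (U z w) = w := fun w => by
      have := congrArg (fun T : H →L[ℂ] H => T w) (Ring.inverse_mul_cancel _ hz)
      simpa using this
    have e2 : U z y = A z (G y) + PQ y := by
      change y + (A z (G y) - A z₀ (G y)) = _
      nth_rewrite 1 [← hAG y]
      abel
    have e3 : U z (PQ y) = PQ y := by
      have : G (PQ y) = 0 := hGQ (πQ y)
      simp [U, this]
    have := e1 y
    rw [e2, map_add] at this
    rw [← e3, e1] at this
    exact this
  have hbij : ∀ z, IsUnit (U z) → IsUnit (A z) → Function.Bijective (S z) := by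
    intro z hz hAz
    have hYunit : IsUnit (Y z) := hz.ringInverse.mul hAz
    have hYbij : Function.Bijective (Y z) := by
      rwa [← ContinuousLinearMap.isUnit_iff_bijective]
    constructor
    · rw [injective_iff_map_eq_zero]
      intro m hm
      have h1 := hYG z hz (Y z m)
      have h2 : PQ (Y z m) = 0 := by
        change ((S z m : Q) : H) = 0
        rw [hm]; rfl
      rw [h2, add_zero] at h1
      exact hMG m _ (hYbij.1 h1).symm
    · intro q
      obtain ⟨h, hh⟩ := hYbij.2 q
      obtain ⟨m, hm⟩ := hGA h
      refine ⟨m, ?_⟩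
      have h1 := hYG z hz (A z₀ h)
      have h2 : PQ (A z₀ h) = 0 := by simp [PQ, hπA]
      rw [h2, add_zero] at h1
      change πQ (Y z m) = q
      have h3 : Y z m = q - A z₀ h := by
        rw [← hh, ← h1, ← map_sub]
        exact congrArg (Y z) (eq_sub_of_add_eq' hm)
      rw [h3, map_sub, hπA, hπ, sub_zero]
  -- Bijectivity of `S` at one nearby point identifies `M` with `Q`; the finite-dimensional case
  -- then applies to `e.symm ∘ S z`, a family of endomorphisms of `M`.
  obtain ⟨z₁, hz₁, hz₁'⟩ := ((hUunit.filter_mono nhdsWithin_le_nhds).and hU).exists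
  let e : M ≃L[ℂ] Q := (LinearEquiv.ofBijective (S z₁ : M →ₗ[ℂ] Q)
    (hbij z₁ hz₁ hz₁')).toContinuousLinearEquiv
  let Si : ℂ → Q →L[ℂ] M := fun z =>
    (Ring.inverse ((e.symm : Q →L[ℂ] M) ∘L S z)) ∘L (e.symm : Q →L[ℂ] M)
  have hSi : ∀ z, Function.Bijective (S z) → ∀ q, S z (Si z q) = q := by
    intro z hz q
    have hunit : IsUnit ((e.symm : Q →L[ℂ] M) ∘L S z) := by
      rw [ContinuousLinearMap.isUnit_iff_bijective]
      exact e.symm.bijective.comp hz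
    have := congrArg (fun T : M →L[ℂ] M => T (e.symm q)) (Ring.mul_inverse_cancel _ hunit)
    exact e.symm.injective this
  have hSim : MeromorphicAt (fun z => Ring.inverse ((e.symm : Q →L[ℂ] M) ∘L S z)) z₀ :=
    meromorphicAt_ringInverse_of_finiteDimensional (analyticAt_const.clm_comp' hS)
  -- Block elimination: with y = U⁻¹h, the solution of A(z)w = h is w = G y + (1 - G Y) S⁻¹ πQ y.
  have hmain : MeromorphicAt (fun z => (G ∘L Ui z) +
      ((ContinuousLinearMap.id ℂ H - G ∘L Y z) ∘L M.subtypeL) ∘L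
        ((Ring.inverse ((e.symm : Q →L[ℂ] M) ∘L S z)) ∘L
          ((e.symm : Q →L[ℂ] M) ∘L (πQ ∘L Ui z)))) z₀ := by
    refine (analyticAt_const.clm_comp' hUi).meromorphicAt.add ?_
    refine hSim.clm_comp_comp ?_ ?_
    · exact (analyticAt_const.sub (analyticAt_const.clm_comp' hY)).clm_comp' analyticAt_const
    · exact analyticAt_const.clm_comp' (analyticAt_const.clm_comp' hUi)
  refine hmain.congr ?_
  filter_upwards [hUunit.filter_mono nhdsWithin_le_nhds, hU] with z hz hAz
  have hSz := hSi z (hbij z hz hAz)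
  have hYunit : IsUnit (Y z) := hz.ringInverse.mul hAz
  apply hAz.mul_left_cancel
  rw [Ring.mul_inverse_cancel _ hAz]
  apply hz.ringInverse.mul_left_cancel
  rw [← mul_assoc, mul_one]
  ext h
  set y := Ui z h with hy
  set m := Si z (πQ y) with hm
  change Y z (G y + ((m : H) - G (Y z m))) = y
  have e1 := hYG z hz (y - Y z m)
  have e2 : PQ (y - Y z m) = 0 := by
    have : πQ (Y z m) = πQ y := hSz (πQ y)
    simp [PQ, this]
  rw [e2, add_zero] at e1
  have e3 : G y + ((m : H) - G (Y z m)) = G (y - Y z m) + m := by rw [map_sub]; abel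
  rw [e3, map_add, e1]
  abel

end MeromorphicInverse

/-! ### Clearing the pole at one -/

section Regularization

open Filter Topology

variable {H : Type*} [NormedAddCommGroup H] [InnerProductSpace ℂ H]

theorem differentiable_arPoly {k : ℕ} (a : Fin k → H →L[ℂ] H) : Differentiable ℂ (arPoly a) := by
  unfold arPoly
  fun_prop

variable [CompleteSpace H]

/-- `A(z)⁻¹` becomes holomorphic and nonvanishing near the closed unit disc when composed with a
nonzero operator `V` and multiplied by a suitable power of `1 - z`. -/
theorem HasUnitRootOfFiniteType.exists_regularization {k : ℕ} {a : Fin k → H →L[ℂ] H}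
    (ha : HasUnitRootOfFiniteType a) {F : Type*} [NormedAddCommGroup F] [NormedSpace ℂ F]
    (V : H →L[ℂ] F) (hV : V ≠ 0) :
    ∃ (b : ℕ) (G : ℂ → H →L[ℂ] F) (ρ : ℝ), 1 < ρ ∧ DifferentiableOn ℂ G (Metric.ball 0 ρ) ∧
      (∀ z ∈ Metric.ball (0 : ℂ) ρ, (G z).comp (arPoly a z) = (1 - z) ^ b • V) ∧
      (∀ z ∈ Metric.ball (0 : ℂ) ρ, z ≠ 1 → IsUnit (arPoly a z)) ∧
      ∀ z ∈ Metric.ball (0 : ℂ) ρ, G z ≠ 0 := by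
  obtain ⟨ρ, hρ, hinv⟩ := ha.invertible
  have hAd := differentiable_arPoly a
  have hball : Metric.ball (0 : ℂ) ρ ∈ 𝓝 (1 : ℂ) :=
    Metric.isOpen_ball.mem_nhds (by simpa using hρ)
  have hU : ∀ᶠ z in 𝓝[≠] (1 : ℂ), IsUnit (arPoly a z) := by
    filter_upwards [mem_nhdsWithin_of_mem_nhds hball, self_mem_nhdsWithin] with z hz hz1
    exact hinv z (by simpa using hz) hz1
  have hAan : AnalyticAt ℂ (arPoly a) 1 := hAd.analyticAt 1
  set W : ℂ → H →L[ℂ] F := fun z => V.comp (Ring.inverse (arPoly a z)) with hW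
  have hWA : ∀ z, IsUnit (arPoly a z) → (W z).comp (arPoly a z) = V := by
    intro z hz
    have := Ring.inverse_mul_cancel _ hz
    rw [hW, ContinuousLinearMap.comp_assoc]
    change V.comp (Ring.inverse (arPoly a z) * arPoly a z) = V
    rw [this]; rfl
  have hWm : MeromorphicAt W 1 :=
    (meromorphicAt_ringInverse_of_isFredholm hAan ha.eigenvalue.fredholm hU).clm_comp_comp
      (L := fun _ => V) (R := fun _ => ContinuousLinearMap.id ℂ H) analyticAt_const analyticAt_const
  have hW0 : ∀ᶠ z in 𝓝[≠] (1 : ℂ), W z ≠ 0 := by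
    filter_upwards [hU] with z hz h0
    apply hV
    rw [← hWA z hz, h0, ContinuousLinearMap.zero_comp]
  obtain ⟨g, hg, hg1, hWg⟩ := (meromorphicOrderAt_ne_top_iff hWm).1
    ((meromorphicOrderAt_ne_top_iff_eventually_ne_zero hWm).2 hW0)
  set n := (meromorphicOrderAt W 1).untop₀
  -- A zero of `W` at one would make V = W(z) A(z) tend to zero.
  have hn : n ≤ 0 := by
    by_contra! hn
    obtain ⟨m, hm⟩ := Int.eq_ofNat_of_zero_le hn.le
    rw [hm] at hn hWg
    have hlim : Tendsto (fun z => (z - 1) ^ m • (g z).comp (arPoly a z)) (𝓝[≠] (1 : ℂ)) (𝓝 0) := by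
      have hc : ContinuousAt (fun z => (z - 1) ^ m • (g z).comp (arPoly a z)) (1 : ℂ) :=
        (by fun_prop : ContinuousAt (fun z : ℂ => (z - 1) ^ m) 1).smul
          (hg.continuousAt.clm_comp hAan.continuousAt)
      have := hc.tendsto
      rw [sub_self, zero_pow (by omega), zero_smul] at this
      exact this.mono_left nhdsWithin_le_nhds
    have hV' : Tendsto (fun z => (z - 1) ^ m • (g z).comp (arPoly a z)) (𝓝[≠] (1 : ℂ)) (𝓝 V) := by
      refine tendsto_const_nhds.congr' ?_
      filter_upwards [hU, hWg] with z hz hz'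
      rw [← hWA z hz, hz', zpow_natCast, ContinuousLinearMap.smul_comp]
    exact hV (tendsto_nhds_unique hV' hlim)
  obtain ⟨b, hb⟩ := Int.eq_ofNat_of_zero_le (neg_nonneg.2 hn)
  have hWg' : ∀ᶠ z in 𝓝[≠] (1 : ℂ), (1 - z) ^ b • W z = (-1 : ℂ) ^ b • g z := by
    filter_upwards [hWg, self_mem_nhdsWithin] with z hz hz1
    have hz1' : z - 1 ≠ 0 := sub_ne_zero.2 hz1
    rw [hz, show n = -(b : ℤ) by omega, smul_smul, zpow_neg, zpow_natCast,
      show (1 - z) = (-1) * (z - 1) by ring, mul_pow, mul_assoc,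
      mul_inv_cancel₀ (pow_ne_zero _ hz1'), mul_one]
  classical
  -- The singularity is removed by hand; the sign comes from passing from powers of `z - 1` to
  -- powers of `1 - z`.
  let G : ℂ → H →L[ℂ] F := Function.update (fun z => (1 - z) ^ b • W z) 1 ((-1 : ℂ) ^ b • g 1)
  have hG1 : G 1 = (-1 : ℂ) ^ b • g 1 := Function.update_self ..
  have hGz : ∀ z, z ≠ 1 → G z = (1 - z) ^ b • W z := fun z hz => Function.update_of_ne hz ..
  have hGg : G =ᶠ[𝓝 1] fun z => (-1 : ℂ) ^ b • g z := by
    rw [eventually_nhdsWithin_iff] at hWg'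
    filter_upwards [hWg'] with z hz
    by_cases h : z = 1
    · rw [h, hG1]
    · rw [hGz z h, hz h]
  have hGan : AnalyticAt ℂ G 1 := (hg.const_smul (c := (-1 : ℂ) ^ b)).congr hGg.symm
  have hunit : ∀ z ∈ Metric.ball (0 : ℂ) ρ, z ≠ 1 → IsUnit (arPoly a z) :=
    fun z hz hz1 => hinv z (by simpa using hz) hz1
  have hGA : ∀ z ∈ Metric.ball (0 : ℂ) ρ, z ≠ 1 → (G z).comp (arPoly a z) = (1 - z) ^ b • V := by
    intro z hz hz1
    rw [hGz z hz1, ContinuousLinearMap.smul_comp, hWA z (hunit z hz hz1)]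
  refine ⟨b, G, ρ, hρ, ?_, ?_, hunit, ?_⟩
  · intro z hz
    by_cases h : z = 1
    · rw [h]; exact hGan.differentiableAt.differentiableWithinAt
    · have h1 : DifferentiableAt ℂ (fun z => Ring.inverse (arPoly a z)) z := by
        have := (differentiableAt_inverse (𝕜 := ℂ) (hunit z hz h))
        exact DifferentiableAt.comp z this hAd.differentiableAt
      have h2 : DifferentiableAt ℂ (fun z => (1 - z) ^ b • W z) z :=
        (by fun_prop : DifferentiableAt ℂ (fun z : ℂ => (1 - z) ^ b) z).smul
          ((differentiableAt_const V).clm_comp h1)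
      refine (h2.congr_of_eventuallyEq ?_).differentiableWithinAt
      filter_upwards [isOpen_ne.mem_nhds h] with w hw using hGz w hw
  · intro z hz
    by_cases h : z = 1
    · have h1 : Tendsto (fun z => (G z).comp (arPoly a z)) (𝓝[≠] (1 : ℂ))
          (𝓝 ((G 1).comp (arPoly a 1))) :=
        (hGan.continuousAt.clm_comp hAan.continuousAt).tendsto.mono_left nhdsWithin_le_nhds
      have h2 : Tendsto (fun z : ℂ => (1 - z) ^ b • V) (𝓝[≠] (1 : ℂ)) (𝓝 ((1 - 1 : ℂ) ^ b • V)) :=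
        ((by fun_prop : Continuous (fun z : ℂ => (1 - z) ^ b • V)).tendsto 1).mono_left
          nhdsWithin_le_nhds
      rw [h]
      refine tendsto_nhds_unique h1 (h2.congr' ?_)
      filter_upwards [mem_nhdsWithin_of_mem_nhds hball, self_mem_nhdsWithin] with w hw hw1
      exact (hGA w hw hw1).symm
    · exact hGA z hz h
  · intro z hz h0
    by_cases h : z = 1
    · rw [h, hG1] at h0
      exact smul_ne_zero (pow_ne_zero _ (by norm_num)) hg1 h0
    · have := hGA z hz h
      rw [h0, ContinuousLinearMap.zero_comp] at this
      exact smul_ne_zero (pow_ne_zero _ (sub_ne_zero.2 (Ne.symm h))) hV this.symm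

end Regularization

/-! ### Sequences of exponentially decaying coefficients -/

section ExponentialDecay

variable {E : Type*} [NormedAddCommGroup E]

/-- The norms of the terms of the sequence decay exponentially. -/
def ExpDecay (B : ℕ → E) : Prop :=
  ∃ K q : ℝ, 0 < q ∧ q < 1 ∧ ∀ n, ‖B n‖ ≤ K * q ^ n

theorem ExpDecay.exists_summable {B : ℕ → E} (hB : ExpDecay B) :
    ∃ ρ : ℝ, 1 < ρ ∧ ∀ r, 0 ≤ r → r < ρ → Summable fun n => ‖B n‖ * r ^ n := by
  obtain ⟨K, q, hq0, hq1, h⟩ := hB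
  refine ⟨q⁻¹, (one_lt_inv₀ hq0).2 hq1, fun r hr hrq => ?_⟩
  have hlt : q * r < 1 := by
    calc q * r < q * q⁻¹ := by gcongr
      _ = 1 := mul_inv_cancel₀ hq0.ne'
  refine Summable.of_nonneg_of_le (fun n => by positivity) (fun n => ?_)
    ((summable_geometric_of_lt_one (by positivity) hlt).mul_left K)
  calc ‖B n‖ * r ^ n ≤ K * q ^ n * r ^ n := by gcongr; exact h n
    _ = K * (q * r) ^ n := by rw [mul_pow]; ring

theorem ExpDecay.summable_norm {B : ℕ → E} (hB : ExpDecay B) : Summable fun n => ‖B n‖ := by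
  obtain ⟨ρ, hρ, h⟩ := hB.exists_summable
  simpa using h 1 zero_le_one hρ

theorem ExpDecay.of_norm_le {F : Type*} [NormedAddCommGroup F] {B : ℕ → E} (hB : ExpDecay B)
    {D : ℕ → F} (M : ℝ) (hM : 0 ≤ M) (h : ∀ n, ‖D n‖ ≤ M * ‖B n‖) : ExpDecay D := by
  obtain ⟨K, q, hq0, hq1, hK⟩ := hB
  refine ⟨M * K, q, hq0, hq1, fun n => (h n).trans ?_⟩
  rw [mul_assoc]
  exact mul_le_mul_of_nonneg_left (hK n) hM

theorem ExpDecay.of_eq_zero {B : ℕ → E} (N : ℕ) (h : ∀ n, N < n → B n = 0) : ExpDecay B := by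
  refine ⟨(∑ n ∈ Finset.range (N + 1), ‖B n‖) * 2 ^ N, 1 / 2, by norm_num, by norm_num,
    fun n => ?_⟩
  by_cases hn : N < n
  · rw [h n hn, norm_zero]; positivity
  · have h1 : ‖B n‖ ≤ ∑ n ∈ Finset.range (N + 1), ‖B n‖ :=
      Finset.single_le_sum (f := fun n => ‖B n‖) (fun _ _ => norm_nonneg _)
        (Finset.mem_range.2 (by omega))
    have h2 : (1 : ℝ) ≤ 2 ^ N * (1 / 2) ^ n := by
      rw [one_div, inv_pow, ← div_eq_mul_inv, one_le_div (by positivity)]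
      exact pow_le_pow_right₀ (by norm_num) (by omega)
    calc ‖B n‖ = ‖B n‖ * 1 := (mul_one _).symm
      _ ≤ (∑ n ∈ Finset.range (N + 1), ‖B n‖) * (2 ^ N * (1 / 2) ^ n) := by
        gcongr
      _ = _ := by ring

/-- The coefficients of a function that is holomorphic on a disc of radius larger than one. -/
theorem exists_expDecay_coeff [NormedSpace ℂ E] [CompleteSpace E] {f : ℂ → E} {ρ : ℝ} (hρ : 1 < ρ)
    (hf : DifferentiableOn ℂ f (Metric.ball 0 ρ)) :
    ∃ B : ℕ → E, ExpDecay B ∧ ∀ z : ℂ, ‖z‖ ≤ 1 → HasSum (fun n => z ^ n • B n) (f z) := by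
  obtain ⟨R, hR1, hRρ⟩ := exists_between hρ
  obtain ⟨r, hr1, hrR⟩ := exists_between hR1
  lift R to NNReal using by linarith
  lift r to NNReal using by linarith
  have hps := (hf.mono (Metric.closedBall_subset_ball hRρ)).hasFPowerSeriesOnBall
    (by exact_mod_cast (zero_lt_one.trans hR1))
  set p := cauchyPowerSeries f 0 R
  obtain ⟨K, hK, hpK⟩ := p.norm_le_div_pow_of_pos_of_lt_radius (r := r)
    (by exact_mod_cast (zero_lt_one.trans hr1))
    (lt_of_lt_of_le (by exact_mod_cast hrR) hps.r_le)
  refine ⟨p.coeff, ⟨K, (r : ℝ)⁻¹, by positivity, inv_lt_one_of_one_lt₀ hr1, fun n => ?_⟩,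
    fun z hz => ?_⟩
  · rw [← p.norm_apply_eq_norm_coef, inv_pow, ← div_eq_mul_inv]
    exact hpK n
  · have := hps.hasSum (y := z) (by
      rw [Metric.mem_eball, edist_zero_right, enorm_eq_nnnorm]
      exact_mod_cast lt_of_le_of_lt hz hR1)
    simpa using this

theorem coeff_unique [NormedSpace ℂ E] {f : ℂ → E} {B D : ℕ → E}
    (hB : ∀ z : ℂ, ‖z‖ ≤ 1 → HasSum (fun n => z ^ n • B n) (f z))
    (hD : ∀ z : ℂ, ‖z‖ ≤ 1 → HasSum (fun n => z ^ n • D n) (f z)) : B = D := by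
  have key : ∀ B : ℕ → E, (∀ z : ℂ, ‖z‖ ≤ 1 → HasSum (fun n => z ^ n • B n) (f z)) →
      HasFPowerSeriesAt f
        ((fun n => ContinuousMultilinearMap.mkPiRing ℂ (Fin n) (B n)) :
          FormalMultilinearSeries ℂ ℂ E) 0 := by
    intro B hB
    refine hasFPowerSeriesAt_iff.2 ?_
    filter_upwards [Metric.closedBall_mem_nhds (0 : ℂ) zero_lt_one] with z hz
    simpa [FormalMultilinearSeries.coeff] using hB z (by simpa using hz)
  have h := (key B hB).eq_formalMultilinearSeries (key D hD)
  funext n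
  have := congrArg (fun p : FormalMultilinearSeries ℂ ℂ E => p.coeff n) h
  simpa [FormalMultilinearSeries.coeff] using this

end ExponentialDecay

/-! ### Cauchy products of operator power series -/

section Convolution

/-- Iterated sums rearranged along antidiagonals. -/
theorem HasSum.antidiagonal_of_fiberwise {E : Type*} [NormedAddCommGroup E] {f : ℕ × ℕ → E}
    (hf : Summable f) {g : ℕ → E} (hg : ∀ n, HasSum (fun m => f (n, m)) (g n)) {s : E}
    (hs : HasSum g s) : HasSum (fun N => ∑ p ∈ Finset.HasAntidiagonal.antidiagonal N, f p) s := by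
  have h1 : HasSum f s := by
    have := hf.hasSum
    rwa [(this.prod_fiberwise hg).unique hs] at this
  have h2 := (Finset.HasAntidiagonal.sigmaAntidiagonalEquivProd (A := ℕ)).hasSum_iff.2 h1
  refine h2.sigma fun N => ?_
  have := Finset.hasSum (Finset.HasAntidiagonal.antidiagonal N) f
  exact this

variable {E F G : Type*} [NormedAddCommGroup E] [NormedSpace ℂ E]
  [NormedAddCommGroup F] [NormedSpace ℂ F] [NormedAddCommGroup G] [NormedSpace ℂ G]

/-- Coefficients of the composition of two power series with operator coefficients. -/
def convCoeff (B : ℕ → F →L[ℂ] G) (A : ℕ → E →L[ℂ] F) (N : ℕ) : E →L[ℂ] G :=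
  ∑ p ∈ Finset.HasAntidiagonal.antidiagonal N, (B p.1).comp (A p.2)

/-- Exponential decay makes the double series absolutely summable on the closed disc, boundary
included, so it may be summed along antidiagonals. The point z = 1 is needed later. -/
theorem hasSum_convCoeff [CompleteSpace G] {B : ℕ → F →L[ℂ] G} {A : ℕ → E →L[ℂ] F}
    (hB : ExpDecay B) (hA : ExpDecay A) {z : ℂ} (hz : ‖z‖ ≤ 1) {b : F →L[ℂ] G} {a : E →L[ℂ] F}
    (hb : HasSum (fun n => z ^ n • B n) b) (ha : HasSum (fun n => z ^ n • A n) a) :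
    HasSum (fun n => z ^ n • convCoeff B A n) (b.comp a) := by
  have hsum : Summable fun p : ℕ × ℕ => (z ^ p.1 • B p.1).comp (z ^ p.2 • A p.2) := by
    refine Summable.of_norm_bounded (Summable.mul_of_nonneg hB.summable_norm hA.summable_norm
      (fun _ => norm_nonneg _) (fun _ => norm_nonneg _)) fun p => ?_
    refine (ContinuousLinearMap.opNorm_comp_le _ _).trans ?_
    have : ∀ n : ℕ, ‖z‖ ^ n ≤ 1 := fun n => pow_le_one₀ (norm_nonneg _) hz
    rw [norm_smul, norm_smul, norm_pow, norm_pow]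
    gcongr
    · exact mul_le_of_le_one_left (norm_nonneg _) (this _)
    · exact mul_le_of_le_one_left (norm_nonneg _) (this _)
  have h := HasSum.antidiagonal_of_fiberwise hsum
    (g := fun n => (z ^ n • B n).comp a) (s := b.comp a)
    (fun n => ((ContinuousLinearMap.compL ℂ E F G) (z ^ n • B n)).hasSum ha)
    (((ContinuousLinearMap.compL ℂ E F G).flip a).hasSum hb)
  convert! h using 2 with N
  rw [convCoeff, Finset.smul_sum]
  refine Finset.sum_congr rfl fun p hp => ?_
  rw [ContinuousLinearMap.smul_comp, ContinuousLinearMap.comp_smul, smul_smul, ← pow_add,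
    Finset.HasAntidiagonal.mem_antidiagonal.1 hp]

end Convolution

/-! ### Filters B(L) acting on processes of subexponential growth -/

section Filters

variable {Ω E F G : Type*} [MeasurableSpace Ω] {P : Measure Ω}
  [NormedAddCommGroup E] [NormedSpace ℂ E] [NormedAddCommGroup F] [NormedSpace ℂ F]
  [NormedAddCommGroup G] [NormedSpace ℂ G]

-- Tonelli: the sum of the norms has finite expectation, hence is finite almost surely.
omit [NormedSpace ℂ E] in
theorem ae_summable_norm_of_summable_integral_norm {ι : Type*} [Countable ι] {f : ι → Ω → E}
    (hf : ∀ i, Integrable (f i) P) (hs : Summable fun i => ∫ ω, ‖f i ω‖ ∂P) :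
    ∀ᵐ ω ∂P, Summable fun i => ‖f i ω‖ := by
  have h1 : ∀ i, ∫⁻ ω, ‖f i ω‖ₑ ∂P = ENNReal.ofReal (∫ ω, ‖f i ω‖ ∂P) := fun i =>
    (ofReal_integral_norm_eq_lintegral_enorm (hf i)).symm
  have h2 : ∫⁻ ω, ∑' i, ‖f i ω‖ₑ ∂P ≠ ⊤ := by
    rw [lintegral_tsum fun i => (hf i).1.enorm]
    simp_rw [h1]
    exact hs.tsum_ofReal_ne_top
  filter_upwards [ae_lt_top' (AEMeasurable.tsum fun i => (hf i).1.enorm) h2] with ω hω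
  have := ENNReal.tsum_coe_ne_top_iff_summable.1 hω.ne
  exact NNReal.summable_coe.2 this

/-- `u = B(L) x` where `L` is the lag operator. -/
def IsFilter (P : Measure Ω) (B : ℕ → E →L[ℂ] F) (x : ℤ → Ω → E) (u : ℤ → Ω → F) : Prop :=
  ∀ t : ℤ, ∀ᵐ ω ∂P, HasSum (fun n : ℕ => B n (x (t - n) ω)) (u t ω)

/-- The process grows slower than every exponential towards the past. -/
structure MomentBound (P : Measure Ω) (x : ℤ → Ω → E) : Prop where
  integrable : ∀ t, Integrable (x t) P
  bound : ∀ r : ℝ, 1 < r → ∀ t : ℤ, ∃ K : ℝ, ∀ n : ℕ, ∫ ω, ‖x (t - n) ω‖ ∂P ≤ K * r ^ n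

theorem integral_norm_clm_apply_le {x : Ω → E} (hx : Integrable x P) (B : E →L[ℂ] F) :
    ∫ ω, ‖B (x ω)‖ ∂P ≤ ‖B‖ * ∫ ω, ‖x ω‖ ∂P := by
  rw [← integral_const_mul]
  exact integral_mono (B.integrable_comp hx).norm (hx.norm.const_mul _)
    fun ω => B.le_opNorm (x ω)

/-- The rate r in the moment bound may be taken arbitrarily close to one, in particular below the
radius of convergence of ∑ ‖B n‖ rⁿ. -/
theorem MomentBound.summable {x : ℤ → Ω → E} (hx : MomentBound P x) {B : ℕ → E →L[ℂ] F}
    (hB : ExpDecay B) (t : ℤ) : Summable fun n : ℕ => ∫ ω, ‖B n (x (t - n) ω)‖ ∂P := by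
  obtain ⟨ρ, hρ, hs⟩ := hB.exists_summable
  obtain ⟨r, hr1, hrρ⟩ := exists_between hρ
  obtain ⟨K, hK⟩ := hx.bound r hr1 t
  refine Summable.of_nonneg_of_le (fun n => integral_nonneg fun _ => norm_nonneg _) (fun n => ?_)
    ((hs r (by linarith) hrρ).mul_left K)
  refine (integral_norm_clm_apply_le (hx.integrable _) _).trans ?_
  calc ‖B n‖ * ∫ ω, ‖x (t - n) ω‖ ∂P ≤ ‖B n‖ * (K * r ^ n) := by gcongr; exact hK n
    _ = _ := by ring

theorem MomentBound.exists_isFilter [CompleteSpace F] {x : ℤ → Ω → E} (hx : MomentBound P x)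
    {B : ℕ → E →L[ℂ] F} (hB : ExpDecay B) : ∃ u, IsFilter P B x u := by
  refine ⟨fun t ω => ∑' n : ℕ, B n (x (t - n) ω), fun t => ?_⟩
  filter_upwards [ae_summable_norm_of_summable_integral_norm
    (fun n : ℕ => (B n).integrable_comp (hx.integrable (t - n))) (hx.summable hB t)] with ω hω
  exact hω.of_norm.hasSum

theorem IsFilter.unique {B : ℕ → E →L[ℂ] F} {x : ℤ → Ω → E} {u w : ℤ → Ω → F}
    (hu : IsFilter P B x u) (hw : IsFilter P B x w) (t : ℤ) : u t =ᵐ[P] w t := by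
  filter_upwards [hu t, hw t] with ω h1 h2 using h1.unique h2

theorem IsFilter.congr {B : ℕ → E →L[ℂ] F} {x : ℤ → Ω → E} {u w : ℤ → Ω → F}
    (hu : IsFilter P B x u) (hw : ∀ t, u t =ᵐ[P] w t) : IsFilter P B x w := by
  intro t
  filter_upwards [hu t, hw t] with ω h1 h2
  rwa [← h2]

theorem IsFilter.integral_eq_zero [CompleteSpace E] [CompleteSpace F]
    {B : ℕ → E →L[ℂ] F} {x : ℤ → Ω → E} {u : ℤ → Ω → F}
    (hu : IsFilter P B x u) (hB : ExpDecay B) (hx : MomentBound P x)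
    (h0 : ∀ t, ∫ ω, x t ω ∂P = 0) (t : ℤ) : ∫ ω, u t ω ∂P = 0 := by
  have h := hasSum_integral_of_summable_integral_norm
    (fun n : ℕ => (B n).integrable_comp (hx.integrable (t - n))) (hx.summable hB t)
  have h1 : ∀ n : ℕ, ∫ ω, B n (x (t - n) ω) ∂P = 0 := fun n => by
    rw [(B n).integral_comp_comm (hx.integrable _), h0, map_zero]
  simp_rw [h1] at h
  rw [hasSum_zero.unique h]
  refine integral_congr_ae ?_
  filter_upwards [hu t] with ω hω using hω.tsum_eq.symm

/-- Associativity B(L)(A(L)x) = (BA)(L)x. The lag of the term p is p.1 + p.2, so its expected norm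
is at most K ‖B p.1‖ r^p.1 ‖A p.2‖ r^p.2; the double series therefore converges absolutely almost
surely. This is what allows an autoregression to be inverted without initial conditions. -/
theorem IsFilter.comp [CompleteSpace F] [CompleteSpace G]
    {B : ℕ → F →L[ℂ] G} {A : ℕ → E →L[ℂ] F} {x : ℤ → Ω → E} {u : ℤ → Ω → F} {w : ℤ → Ω → G}
    (hB : ExpDecay B) (hA : ExpDecay A) (hx : MomentBound P x)
    (hu : IsFilter P A x u) (hw : IsFilter P B u w) : IsFilter P (convCoeff B A) x w := by
  obtain ⟨ρ, hρ, hs⟩ := hB.exists_summable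
  obtain ⟨ρ', hρ', hs'⟩ := hA.exists_summable
  obtain ⟨r, hr1, hr⟩ := exists_between (lt_min hρ hρ')
  have hsB := hs r (by linarith) (hr.trans_le (min_le_left _ _))
  have hsA := hs' r (by linarith) (hr.trans_le (min_le_right _ _))
  intro t
  obtain ⟨K, hK⟩ := hx.bound r hr1 t
  let f : ℕ × ℕ → Ω → G := fun p ω => ((B p.1).comp (A p.2)) (x (t - (p.1 + p.2 : ℕ)) ω)
  have hfi : ∀ p, Integrable (f p) P := fun p =>
    ((B p.1).comp (A p.2)).integrable_comp (hx.integrable _)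
  have hfs : Summable fun p => ∫ ω, ‖f p ω‖ ∂P := by
    refine Summable.of_nonneg_of_le (fun p => integral_nonneg fun _ => norm_nonneg _)
      (fun p => ?_) ((Summable.mul_of_nonneg hsB hsA (fun _ => by simp only [Pi.zero_apply]; positivity)
        (fun _ => by simp only [Pi.zero_apply]; positivity)).mul_left K)
    refine (integral_norm_clm_apply_le (hx.integrable _) _).trans ?_
    calc ‖(B p.1).comp (A p.2)‖ * ∫ ω, ‖x (t - (p.1 + p.2 : ℕ)) ω‖ ∂P
        ≤ (‖B p.1‖ * ‖A p.2‖) * (K * r ^ (p.1 + p.2)) := by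
          gcongr
          · exact ContinuousLinearMap.opNorm_comp_le _ _
          · exact hK _
      _ = _ := by rw [pow_add]; ring
  have hall : ∀ᵐ ω ∂P, ∀ n : ℕ, HasSum (fun m : ℕ => A m (x (t - n - m) ω)) (u (t - n) ω) :=
    ae_all_iff.2 fun n => hu (t - n)
  filter_upwards [ae_summable_norm_of_summable_integral_norm hfi hfs, hall, hw t] with ω h1 h2 h3
  have h4 := HasSum.antidiagonal_of_fiberwise (f := fun p => f p ω) h1.of_norm
    (g := fun n => B n (u (t - n) ω)) (fun n => by
      have := (B n).hasSum (h2 n)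
      convert! this using 3 with m
      simp [f, sub_sub]) h3
  convert! h4 using 2 with N
  rw [convCoeff, sum_apply]
  refine Finset.sum_congr rfl fun p hp => ?_
  simp only [f, Finset.HasAntidiagonal.mem_antidiagonal.1 hp]

end Filters

/-! ### Differences as polynomials in the lag operator -/

section Differencing

open Polynomial

variable {Ω E F : Type*} [MeasurableSpace Ω] {P : Measure Ω}
  [NormedAddCommGroup E] [InnerProductSpace ℂ E] [NormedAddCommGroup F] [InnerProductSpace ℂ F]

/-- The lag operator on processes. -/
def lagEnd (Ω E : Type*) [NormedAddCommGroup E] [InnerProductSpace ℂ E] :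
    Module.End ℂ (ℤ → Ω → E) where
  toFun u t ω := u (t - 1) ω
  map_add' _ _ := rfl
  map_smul' _ _ := rfl

omit [MeasurableSpace Ω] in
theorem lagEnd_pow_apply (n : ℕ) (u : ℤ → Ω → E) (t : ℤ) (ω : Ω) :
    (lagEnd Ω E ^ n) u t ω = u (t - n) ω := by
  induction n generalizing t with
  | zero => simp
  | succ n ih =>
    rw [pow_succ', Module.End.mul_apply]
    change (lagEnd Ω E ^ n) u (t - 1) ω = _
    rw [ih, show t - 1 - (n : ℤ) = t - (n + 1 : ℕ) by push_cast; ring]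

omit [MeasurableSpace Ω] in
theorem diffOp_iterate_apply (b : ℕ) (u : ℤ → Ω → E) (t : ℤ) (ω : Ω) :
    diffOp^[b] u t ω = ∑ n ∈ Finset.range (b + 1), ((1 - X : ℂ[X]) ^ b).coeff n • u (t - n) ω := by
  have h1 : (diffOp : (ℤ → Ω → E) → (ℤ → Ω → E)) = (1 - lagEnd Ω E : Module.End ℂ (ℤ → Ω → E)) :=
    rfl
  have h2 : (1 - lagEnd Ω E) ^ b = aeval (lagEnd Ω E) ((1 - X : ℂ[X]) ^ b) := by simp
  have hdeg : ((1 - X : ℂ[X]) ^ b).natDegree < b + 1 := by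
    rw [natDegree_pow]
    have : (1 - X : ℂ[X]).natDegree ≤ 1 :=
      (natDegree_sub_le _ _).trans (by simp)
    nlinarith
  rw [h1, ← Module.End.coe_pow, h2, aeval_eq_sum_range' hdeg]
  simp only [LinearMap.sum_apply, LinearMap.smul_apply, Finset.sum_apply, Pi.smul_apply,
    lagEnd_pow_apply]

theorem coeff_one_sub_X_pow_eq_zero {b n : ℕ} (hn : b < n) : ((1 - X : ℂ[X]) ^ b).coeff n = 0 := by
  apply coeff_eq_zero_of_natDegree_lt
  refine lt_of_le_of_lt ?_ hn
  rw [natDegree_pow]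
  have : (1 - X : ℂ[X]).natDegree ≤ 1 := (natDegree_sub_le _ _).trans (by simp)
  nlinarith

theorem hasSum_one_sub_pow_smul (b : ℕ) (V : E →L[ℂ] F) (z : ℂ) :
    HasSum (fun n => z ^ n • ((1 - X : ℂ[X]) ^ b).coeff n • V) ((1 - z) ^ b • V) := by
  have h := hasSum_sum_of_ne_finset_zero (L := .unconditional ℕ) (s := Finset.range (b + 1))
    (f := fun n => z ^ n • ((1 - X : ℂ[X]) ^ b).coeff n • V) (fun n hn => by
      rw [coeff_one_sub_X_pow_eq_zero (by simpa using hn), zero_smul, smul_zero])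
  convert! h using 1
  have h2 : (1 - z) ^ b = eval z ((1 - X : ℂ[X]) ^ b) := by simp
  rw [h2, eval_eq_sum_range' (n := b + 1), Finset.sum_smul]
  · refine Finset.sum_congr rfl fun n _ => ?_
    rw [smul_smul, mul_comm]
  · rw [natDegree_pow]
    have : (1 - X : ℂ[X]).natDegree ≤ 1 := (natDegree_sub_le _ _).trans (by simp)
    nlinarith

theorem isFilter_diffOp_iterate (b : ℕ) (V : E →L[ℂ] F) (x : ℤ → Ω → E) :
    IsFilter P (fun n => ((1 - X : ℂ[X]) ^ b).coeff n • V) x (diffOp^[b] fun t ω => V (x t ω)) := by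
  intro t
  refine ae_of_all _ fun ω => ?_
  rw [diffOp_iterate_apply]
  refine hasSum_sum_of_ne_finset_zero fun n hn => ?_
  have : ((1 - X : ℂ[X]) ^ b).coeff n = 0 := coeff_one_sub_X_pow_eq_zero (by simpa using hn)
  simp only [this, zero_smul, zero_apply]

end Differencing

/-! ### From the autoregression to a moving average -/

section Autoregression

variable {H : Type*} [NormedAddCommGroup H] [InnerProductSpace ℂ H]

/-- The coefficients of the polynomial `arPoly a`. -/
def arCoeff {k : ℕ} (a : Fin k → H →L[ℂ] H) : ℕ → H →L[ℂ] H
  | 0 => ContinuousLinearMap.id ℂ H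
  | n + 1 => if h : n < k then -a ⟨n, h⟩ else 0

theorem arCoeff_eq_zero {k : ℕ} (a : Fin k → H →L[ℂ] H) {n : ℕ} (hn : k < n) :
    arCoeff a n = 0 := by
  obtain ⟨m, rfl⟩ : ∃ m, n = m + 1 := ⟨n - 1, by omega⟩
  exact dif_neg (by omega)

theorem sum_arCoeff {k : ℕ} (a : Fin k → H →L[ℂ] H) {M : Type*} [AddCommGroup M]
    (f : ℕ → (H →L[ℂ] H) →+ M) :
    ∑ n ∈ Finset.range (k + 1), f n (arCoeff a n)
      = f 0 (ContinuousLinearMap.id ℂ H) - ∑ i : Fin k, f ((i : ℕ) + 1) (a i) := by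
  rw [Finset.sum_range_succ', add_comm, sub_eq_add_neg, ← Finset.sum_neg_distrib, Finset.sum_range]
  congr 1
  refine Finset.sum_congr rfl fun i _ => ?_
  simp [arCoeff]

theorem hasSum_arCoeff {k : ℕ} (a : Fin k → H →L[ℂ] H) (z : ℂ) :
    HasSum (fun n => z ^ n • arCoeff a n) (arPoly a z) := by
  have h := hasSum_sum_of_ne_finset_zero (L := .unconditional ℕ) (s := Finset.range (k + 1))
    (f := fun n => z ^ n • arCoeff a n) (fun n hn => by
      rw [arCoeff_eq_zero a (by simpa using hn), smul_zero])
  convert! h using 1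
  have := sum_arCoeff a (fun n => DistribSMul.toAddMonoidHom (H →L[ℂ] H) (z ^ n))
  simp only [DistribSMul.toAddMonoidHom_apply, pow_zero, one_smul] at this
  rw [this, arPoly]

variable {Ω : Type*} [MeasurableSpace Ω] {P : Measure Ω} [MeasurableSpace H]

/-- The autoregressive equation read backwards: ε = A(L) x. -/
theorem IsARSolution.isFilter {k : ℕ} {a : Fin k → H →L[ℂ] H} {ε x : ℤ → Ω → H}
    (hx : IsARSolution P a ε x) : IsFilter P (arCoeff a) x ε := by
  intro t
  filter_upwards [hx.eq t] with ω hω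
  have h := hasSum_sum_of_ne_finset_zero (L := .unconditional ℕ) (s := Finset.range (k + 1))
    (f := fun n => arCoeff a n (x (t - n) ω)) (fun n hn => by
      rw [arCoeff_eq_zero a (by simpa using hn), zero_apply])
  convert! h using 1
  have := sum_arCoeff a (fun n => ((ContinuousLinearMap.apply ℂ H (x (t - n) ω)) :
    (H →L[ℂ] H) →ₗ[ℂ] H).toAddMonoidHom)
  simp at this
  rw [this, hω]
  simp

omit [InnerProductSpace ℂ H] [MeasurableSpace H] in
theorem IsSubexponential.momentBound [IsProbabilityMeasure P] {x : ℤ → Ω → H}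
    (hx : IsSubexponential P x) (hx2 : ∀ t, MemLp (x t) 2 P) : MomentBound P x := by
  have hint : ∀ t, Integrable (x t) P := fun t => (hx2 t).integrable (by norm_num)
  have hle : ∀ t, ∫ ω, ‖x t ω‖ ∂P ≤ 1 + ∫ ω, ‖x t ω‖ ^ 2 ∂P := by
    intro t
    have h2 : Integrable (fun ω => ‖x t ω‖ ^ 2) P := (hx2 t).integrable_norm_pow (by norm_num)
    have := integral_mono (hint t).norm ((integrable_const (1 : ℝ)).add h2) (fun ω => by
      simp only [Pi.add_apply]
      nlinarith [sq_nonneg (‖x t ω‖ - 1), norm_nonneg (x t ω)])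
    rw [integral_add' (integrable_const _) h2] at this
    simpa using this
  refine ⟨hint, fun r hr t => ?_⟩
  obtain ⟨K, hK⟩ := hx r hr
  have hK0 : 0 ≤ K := by
    have := hK 0
    rw [pow_zero, mul_one] at this
    exact (integral_nonneg fun _ => by positivity).trans this
  have hr0 : ∀ n : ℕ, 1 ≤ r ^ n := fun n => one_le_pow₀ hr.le
  -- The first |t| lags may reach positive times, about which the growth hypothesis says nothing;
  -- they enter the constant through the finite sum. Later lags have t - n = -m with m ≤ |t| + n.
  refine ⟨∑ m ∈ Finset.range t.natAbs, ∫ ω, ‖x (t - m) ω‖ ∂P + (1 + K * r ^ t.natAbs),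
    fun n => ?_⟩
  have hS : 0 ≤ ∑ m ∈ Finset.range t.natAbs, ∫ ω, ‖x (t - m) ω‖ ∂P :=
    Finset.sum_nonneg fun m _ => integral_nonneg fun _ => norm_nonneg _
  by_cases hn : n < t.natAbs
  · have h1 := Finset.single_le_sum (f := fun m : ℕ => ∫ ω, ‖x (t - m) ω‖ ∂P)
      (fun m _ => integral_nonneg fun _ => norm_nonneg _) (Finset.mem_range.2 hn)
    have h2 : 0 ≤ 1 + K * r ^ t.natAbs := by positivity
    calc _ ≤ _ := h1
      _ ≤ _ := le_add_of_nonneg_right h2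
      _ ≤ _ := le_mul_of_one_le_right (by linarith) (hr0 n)
  · obtain ⟨m, hm⟩ : ∃ m : ℕ, t - n = -(m : ℤ) := ⟨(n - t).toNat, by omega⟩
    rw [hm]
    have hmn : m ≤ t.natAbs + n := by omega
    calc ∫ ω, ‖x (-(m : ℤ)) ω‖ ∂P ≤ 1 + K * r ^ m := (hle _).trans (by gcongr; exact hK m)
      _ ≤ 1 + K * r ^ (t.natAbs + n) := by gcongr; exact hr.le
      _ ≤ 1 * r ^ n + K * r ^ t.natAbs * r ^ n := by
        rw [pow_add, mul_assoc]; gcongr; rw [one_mul]; exact hr0 n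
      _ = (1 + K * r ^ t.natAbs) * r ^ n := by ring
      _ ≤ _ := by gcongr ?_ * _; exact le_add_of_nonneg_left hS

omit [MeasurableSpace H] in
theorem MomentBound.of_isFilter {B : ℕ → H →L[ℂ] H} {N : ℕ} (hB : ∀ n, N < n → B n = 0)
    {x u : ℤ → Ω → H} (hx : MomentBound P x) (hu : IsFilter P B x u) : MomentBound P u := by
  have hsum : ∀ t, u t =ᵐ[P] fun ω => ∑ n ∈ Finset.range (N + 1), B n (x (t - n) ω) := by
    intro t
    filter_upwards [hu t] with ω hω
    refine hω.unique (hasSum_sum_of_ne_finset_zero fun n hn => ?_)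
    rw [hB n (by simpa using hn), zero_apply]
  have hint : ∀ t, Integrable (u t) P := fun t =>
    (integrable_finsetSum _ fun n _ => (B n).integrable_comp (hx.integrable _)).congr (hsum t).symm
  refine ⟨hint, fun r hr t => ?_⟩
  choose K hK using fun n : ℕ => hx.bound r hr (t - n)
  refine ⟨∑ n ∈ Finset.range (N + 1), ‖B n‖ * K n, fun m => ?_⟩
  calc ∫ ω, ‖u (t - m) ω‖ ∂P
      ≤ ∫ ω, ∑ n ∈ Finset.range (N + 1), ‖B n (x (t - m - n) ω)‖ ∂P := by
        refine integral_mono_ae (hint _).norm (integrable_finsetSum _ fun n _ =>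
          ((B n).integrable_comp (hx.integrable _)).norm) ?_
        filter_upwards [hsum (t - m)] with ω hω
        rw [hω]
        exact norm_sum_le _ _
    _ = ∑ n ∈ Finset.range (N + 1), ∫ ω, ‖B n (x (t - m - n) ω)‖ ∂P :=
        integral_finsetSum _ fun n _ => ((B n).integrable_comp (hx.integrable _)).norm
    _ ≤ ∑ n ∈ Finset.range (N + 1), ‖B n‖ * (K n * r ^ m) := by
        refine Finset.sum_le_sum fun n _ => ?_
        refine (integral_norm_clm_apply_le (hx.integrable _) _).trans ?_
        have := hK n m
        rw [sub_right_comm] at this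
        gcongr
    _ = _ := by rw [Finset.sum_mul]; exact Finset.sum_congr rfl fun n _ => by ring

variable [CompleteSpace H]

/-- The moving average representation of `Δ^b (V x_t)`, where `b` is the order of the pole of
`V A(z)⁻¹` at one. -/
theorem IsARSolution.exists_movingAverage [IsProbabilityMeasure P] {k : ℕ} {a : Fin k → H →L[ℂ] H}
    {ε x : ℤ → Ω → H} (hε : ∀ t, ∫ ω, ε t ω ∂P = 0)
    (hx : IsARSolution P a ε x) (hx' : IsSubexponential P x) {F : Type*} [NormedAddCommGroup F]
    [InnerProductSpace ℂ F] [CompleteSpace F] (V : H →L[ℂ] F) {b : ℕ} {G : ℂ → H →L[ℂ] F} {ρ : ℝ}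
    (hρ : 1 < ρ) (hG : DifferentiableOn ℂ G (Metric.ball 0 ρ))
    (hGA : ∀ z ∈ Metric.ball (0 : ℂ) ρ, (G z).comp (arPoly a z) = (1 - z) ^ b • V) :
    ∃ φ : ℕ → H →L[ℂ] F, ExpDecay φ ∧ (∀ z : ℂ, ‖z‖ ≤ 1 → HasSum (fun n => z ^ n • φ n) (G z)) ∧
      φ 0 = V ∧ IsFilter P φ ε (diffOp^[b] fun t ω => V (x t ω)) ∧
      ∀ t, ∫ ω, (diffOp^[b] fun t ω => V (x t ω)) t ω ∂P = 0 := by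
  obtain ⟨φ, hφ, hφG⟩ := exists_expDecay_coeff hρ hG
  have hxm := hx'.momentBound hx.memLp
  have hεm := hxm.of_isFilter (fun n hn => arCoeff_eq_zero a hn) hx.isFilter
  have hA : ExpDecay (arCoeff a) := .of_eq_zero k fun n hn => arCoeff_eq_zero a hn
  -- Comparison of coefficients in G(z) A(z) = (1 - z)^b V.
  have hconv : convCoeff φ (arCoeff a)
      = fun n => ((1 - Polynomial.X : Polynomial ℂ) ^ b).coeff n • V := by
    refine coeff_unique (f := fun z => (1 - z) ^ b • V) (fun z hz => ?_)
      (fun z _ => hasSum_one_sub_pow_smul b V z)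
    rw [← hGA z (by simpa using hz.trans_lt hρ)]
    exact hasSum_convCoeff hφ hA hz (hφG z hz) (hasSum_arCoeff a z)
  -- The process w = φ(L) ε = φ(L) A(L) x is the filter of x with the coefficients of (1 - z)^b V,
  -- hence equals Δ^b V x almost surely.
  obtain ⟨w, hw⟩ := hεm.exists_isFilter hφ
  have hw' := IsFilter.comp hφ hA hxm hx.isFilter hw
  rw [hconv] at hw'
  have hfil := hw.congr (hw'.unique (isFilter_diffOp_iterate b V x))
  refine ⟨φ, hφ, hφG, ?_, hfil, hfil.integral_eq_zero hφ hεm hε⟩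
  have h0 := congrFun hconv 0
  simpa [convCoeff, arCoeff, Polynomial.coeff_zero_eq_eval_zero] using h0

end Autoregression

/-! ### Toeplitz operators and Wiener-Hopf equations -/

section Toeplitz

open Filter Topology ComplexConjugate

/-- Multiplication of square integrable functions on the circle by a continuous function. -/
def circleMul : C(UnitAddCircle, ℂ) →L[ℂ]
    (Lp ℂ 2 (@AddCircle.haarAddCircle 1 _) →L[ℂ] Lp ℂ 2 (@AddCircle.haarAddCircle 1 _)) :=
  (ContinuousLinearMap.holderL (AddCircle.haarAddCircle (T := 1)) ⊤ 2 2
    (ContinuousLinearMap.mul ℂ ℂ)).comp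
    (ContinuousMap.toLp ⊤ (AddCircle.haarAddCircle (T := 1)) ℂ)

theorem coeFn_circleMul (g : C(UnitAddCircle, ℂ)) (u : Lp ℂ 2 (@AddCircle.haarAddCircle 1 _)) :
    circleMul g u =ᵐ[AddCircle.haarAddCircle] fun θ => g θ * u θ := by
  have h1 := ContinuousLinearMap.coeFn_holder (r := 2) (ContinuousLinearMap.mul ℂ ℂ)
    (ContinuousMap.toLp ⊤ (AddCircle.haarAddCircle (T := 1)) ℂ g) u
  filter_upwards [h1, ContinuousMap.coeFn_toLp (p := ⊤) (𝕜 := ℂ)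
    (AddCircle.haarAddCircle (T := 1)) g] with θ h h2
  rw [← h2]
  exact h

theorem inner_fourierLp_circleMul_fourier (j h : ℤ) (u : Lp ℂ 2 (@AddCircle.haarAddCircle 1 _)) :
    inner ℂ (fourierLp 2 j) (circleMul (fourier h) u) = inner ℂ (fourierLp 2 (j - h)) u := by
  rw [L2.inner_def, L2.inner_def]
  refine integral_congr_ae ?_
  filter_upwards [coeFn_circleMul (fourier h) u, coeFn_fourierLp (T := 1) 2 j,
    coeFn_fourierLp (T := 1) 2 (j - h)] with θ h1 h2 h3
  rw [h1, h2, h3]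
  simp only [RCLike.inner_apply]
  rw [sub_eq_add_neg, fourier_add, fourier_neg, map_mul, Complex.conj_conj]
  ring

/-- Coercivity, from Re ⟨u, g u⟩ = ∫ Re g |u|². It survives compression to a subspace, which
invertibility in general does not. -/
theorem le_re_inner_circleMul {g : C(UnitAddCircle, ℂ)} {m : ℝ} (hg : ∀ θ, m ≤ (g θ).re)
    (u : Lp ℂ 2 (@AddCircle.haarAddCircle 1 _)) :
    m * ‖u‖ ^ 2 ≤ (inner ℂ u (circleMul g u)).re := by
  have hint := L2.integrable_inner (𝕜 := ℂ) u (circleMul g u)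
  have h2 : ‖u‖ ^ 2 = ∫ θ, ‖u θ‖ ^ 2 ∂(@AddCircle.haarAddCircle 1 _) := by
    have := @L2.inner_def UnitAddCircle ℂ ℂ _ _ _ _ _ u u
    have h3 := congrArg Complex.re this
    have h4 := inner_self_eq_norm_sq (𝕜 := ℂ) u
    rw [← h4]
    refine h3.trans ?_
    rw [← RCLike.re_eq_complex_re, ← integral_re (L2.integrable_inner u u)]
    refine integral_congr_ae (ae_of_all _ fun θ => ?_)
    exact inner_self_eq_norm_sq (𝕜 := ℂ) (u θ)
  rw [h2, ← integral_const_mul, L2.inner_def, ← RCLike.re_eq_complex_re, ← integral_re hint]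
  refine integral_mono_ae ?_ hint.re ?_
  · exact ((Lp.memLp u).integrable_norm_pow (by norm_num)).const_mul m
  · filter_upwards [coeFn_circleMul g u] with θ hθ
    rw [hθ]
    have : inner ℂ (u θ) (g θ * u θ) = g θ * (‖u θ‖ ^ 2 : ℝ) := by
      rw [RCLike.inner_apply, mul_assoc, RCLike.mul_conj]
      simp
    rw [this, RCLike.re_eq_complex_re, Complex.re_mul_ofReal]
    exact mul_le_mul_of_nonneg_right (hg θ) (by positivity)

/-- Toeplitz operators whose symbol has a positive real part are invertible on the Hardy space. -/
theorem exists_hardy_solution {g : C(UnitAddCircle, ℂ)} {m : ℝ} (hm : 0 < m)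
    (hg : ∀ θ, m ≤ (g θ).re) :
    ∃ u : Lp ℂ 2 (@AddCircle.haarAddCircle 1 _),
      (∀ n : ℤ, n < 0 → inner ℂ (fourierLp 2 n) u = 0) ∧
      ∀ j : ℕ, inner ℂ (fourierLp 2 (j : ℤ)) (circleMul g u) = if j = 0 then 1 else 0 := by
  let N : Submodule ℂ (Lp ℂ 2 (@AddCircle.haarAddCircle 1 _)) :=
    Submodule.span ℂ {f | ∃ n : ℤ, n < 0 ∧ f = fourierLp 2 n}
  -- The Hardy space, described by vanishing negative Fourier coefficients.
  let S := Nᗮ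
  have hS : ∀ j : ℤ, 0 ≤ j → fourierLp 2 j ∈ S := by
    intro j hj
    rw [Submodule.mem_orthogonal]
    intro f hf
    induction hf using Submodule.span_induction with
    | mem f hf =>
      obtain ⟨n, hn, rfl⟩ := hf
      exact orthonormal_fourier.2 (by omega)
    | zero => simp
    | add f f' _ _ h h' => rw [inner_add_left, h, h', add_zero]
    | smul c f _ h => rw [inner_smul_left, h, mul_zero]
  let T : S →L[ℂ] S := S.orthogonalProjectionOnto ∘L circleMul g ∘L S.subtypeL
  have hT : ∀ v w : S, inner ℂ v (T w) = inner ℂ (v : Lp ℂ 2 (@AddCircle.haarAddCircle 1 _))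
      (circleMul g (w : Lp ℂ 2 (@AddCircle.haarAddCircle 1 _))) := by
    intro v w
    exact Submodule.inner_orthogonalProjectionOnto_eq_of_mem_left v _
  have hunit : IsUnit T := by
    refine ContinuousLinearMap.isUnit_of_forall_le_norm_inner_map T (c := ⟨m, hm.le⟩) hm fun w => ?_
    have h1 := le_re_inner_circleMul hg (w : Lp ℂ 2 (@AddCircle.haarAddCircle 1 _))
    rw [norm_inner_symm, hT]
    calc ‖w‖ ^ 2 * m = m * ‖(w : Lp ℂ 2 (@AddCircle.haarAddCircle 1 _))‖ ^ 2 := mul_comm _ _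
      _ ≤ _ := h1
      _ ≤ _ := Complex.re_le_norm _
  obtain ⟨u, hu⟩ := ((ContinuousLinearMap.isUnit_iff_bijective).1 hunit).2
    ⟨fourierLp 2 0, hS 0 le_rfl⟩
  refine ⟨u, fun n hn => ?_, fun j => ?_⟩
  · exact (Submodule.mem_orthogonal _ _).1 u.2 _ (Submodule.subset_span ⟨n, hn, rfl⟩)
  · have h1 := hT ⟨fourierLp 2 (j : ℤ), hS j (by omega)⟩ u
    rw [← h1, hu, Submodule.coe_inner]
    have := orthonormal_iff_ite.1 (orthonormal_fourier (T := 1)) (j : ℤ) 0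
    simpa using this

/-- Wiener-Hopf equations whose kernel decays exponentially and has a symbol with positive real
part have an exponentially decaying solution. -/
theorem exists_wienerHopf_solution {γ : ℤ → ℂ} {K q m : ℝ} (hq0 : 0 < q) (hq1 : q < 1)
    (hγ : ∀ h, ‖γ h‖ ≤ K * q ^ h.natAbs) (hm : 0 < m)
    (hpos : ∀ θ : UnitAddCircle, m ≤ (∑' h : ℤ, γ h * fourier h θ).re) :
    ∃ a : ℕ → ℂ, ExpDecay a ∧
      ∀ j : ℕ, HasSum (fun n : ℕ => a n * γ (j - n)) (if j = 0 then 1 else 0) := by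
  have hK : 0 ≤ K := by simpa using (norm_nonneg _).trans (hγ 0)
  -- The gap between q and p provides a summable majorant, of ratio q / p, valid for all weights s
  -- in (p, 1) at once.
  obtain ⟨p, hqp, hp1⟩ := exists_between hq1
  have hp0 := hq0.trans hqp
  have hgeo : Summable fun h : ℤ => (q / p) ^ h.natAbs := by
    have h1 := summable_geometric_of_lt_one (by positivity : 0 ≤ q / p) ((div_lt_one hp0).2 hqp)
    exact Summable.of_nat_of_neg (by simpa using h1) (by simpa using h1)
  have hzp : ∀ s : ℝ, p < s → s < 1 → ∀ h : ℤ, s ^ (-h) ≤ (p⁻¹) ^ h.natAbs := by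
    intro s hs hs1 h
    have hs0 := hp0.trans hs
    rcases Int.natAbs_eq h with h' | h'
    · rw [h', zpow_neg, zpow_natCast, ← inv_pow]
      simp only [Int.natAbs_natCast]
      gcongr
    · rw [h', neg_neg, zpow_natCast]
      simp only [Int.natAbs_neg, Int.natAbs_natCast]
      exact (pow_le_one₀ hs0.le hs1.le).trans (one_le_pow₀ ((one_le_inv₀ hp0).2 hp1.le))
  have hbound : ∀ s : ℝ, p < s → s < 1 → ∀ h : ℤ, ‖γ h‖ * s ^ (-h) ≤ K * (q / p) ^ h.natAbs := by
    intro s hs hs1 h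
    have hs0 := hp0.trans hs
    calc ‖γ h‖ * s ^ (-h) ≤ (K * q ^ h.natAbs) * (p⁻¹) ^ h.natAbs := by
          gcongr
          · exact hγ h
          · exact hzp s hs hs1 h
      _ = _ := by rw [div_eq_mul_inv, mul_pow]; ring
  have hγs : Summable γ := by
    refine Summable.of_norm_bounded (hgeo.mul_left K) fun h => (hγ h).trans ?_
    gcongr
    exact (le_div_iff₀ hp0).2 (mul_le_of_le_one_right hq0.le hp1.le)
  -- choice of the radius
  have hlim : Tendsto (fun s : ℝ => ∑' h : ℤ, ‖γ h‖ * |s ^ (-h) - 1|) (𝓝[<] 1)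
      (𝓝 (∑' _ : ℤ, (0 : ℝ))) := by
    refine tendsto_tsum_of_dominated_convergence (bound := fun h => K * (q / p) ^ h.natAbs + ‖γ h‖)
      ((hgeo.mul_left K).add hγs.norm) (fun h => ?_) ?_
    · have hc : ContinuousAt (fun s : ℝ => ‖γ h‖ * |s ^ (-h) - 1|) 1 :=
        continuousAt_const.mul (((continuousAt_zpow₀ (1 : ℝ) (-h) (Or.inl one_ne_zero)).sub
          continuousAt_const).abs)
      have := hc.tendsto
      simp only [one_zpow, sub_self, abs_zero, mul_zero] at this
      exact this.mono_left nhdsWithin_le_nhds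
    · filter_upwards [Ioo_mem_nhdsLT hp1] with s hs h
      have hs0 := hp0.trans hs.1
      rw [Real.norm_of_nonneg (by positivity)]
      calc ‖γ h‖ * |s ^ (-h) - 1| ≤ ‖γ h‖ * (s ^ (-h) + 1) := by
            gcongr
            refine (abs_sub _ _).trans ?_
            rw [abs_one, abs_of_pos (by positivity)]
        _ = ‖γ h‖ * s ^ (-h) + ‖γ h‖ := by ring
        _ ≤ _ := by gcongr ?_ + _; exact hbound s hs.1 hs.2 h
  rw [tsum_zero] at hlim
  obtain ⟨s, hsm, hps, hs1⟩ := ((hlim.eventually_lt_const (half_pos hm)).and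
    (Ioo_mem_nhdsLT hp1)).exists
  have hs0 : 0 < s := hp0.trans hps
  have hsC : (s : ℂ) ≠ 0 := by exact_mod_cast hs0.ne'
  have hgs : Summable fun h : ℤ => (γ h * (s : ℂ) ^ (-h)) • (fourier h : C(UnitAddCircle, ℂ)) := by
    refine Summable.of_norm_bounded (hgeo.mul_left K) fun h => ?_
    rw [norm_smul, fourier_norm, mul_one, norm_mul, norm_zpow, Complex.norm_real,
      Real.norm_of_nonneg hs0.le]
    exact hbound s hps hs1 h
  -- Conjugation of the Toeplitz matrix γ(j - n) by diag(sⁿ) gives this symbol. For s close to one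
  -- its real part is still at least m / 2, and undoing the conjugation multiplies the
  -- square-summable solution by sⁿ, which produces the decay.
  set g : C(UnitAddCircle, ℂ) := ∑' h : ℤ, (γ h * (s : ℂ) ^ (-h)) • fourier h with hgdef
  have hgre : ∀ θ, m / 2 ≤ (g θ).re := by
    intro θ
    have h1 : HasSum (fun h : ℤ => γ h * (s : ℂ) ^ (-h) * fourier h θ) (g θ) := by
      have := (ContinuousMap.evalCLM ℂ θ).hasSum hgs.hasSum
      rw [hgdef]
      simpa using this
    have hn : ∀ h : ℤ, ‖(fourier h θ : ℂ)‖ = 1 := fun h => by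
      rw [fourier_apply]; exact Circle.norm_coe _
    have h2 : Summable fun h : ℤ => γ h * fourier h θ := by
      refine Summable.of_norm ?_
      simpa only [norm_mul, hn, mul_one] using hγs.norm
    have h3 := h1.sub h2.hasSum
    have h4 : Summable fun h : ℤ => ‖γ h‖ * |s ^ (-h) - 1| := by
      refine Summable.of_nonneg_of_le (fun h => by positivity) (fun h => ?_)
        ((hgeo.mul_left K).add hγs.norm)
      calc ‖γ h‖ * |s ^ (-h) - 1| ≤ ‖γ h‖ * (s ^ (-h) + 1) := by
            gcongr
            refine (abs_sub _ _).trans ?_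
            rw [abs_one, abs_of_pos (by positivity)]
        _ = ‖γ h‖ * s ^ (-h) + ‖γ h‖ := by ring
        _ ≤ _ := by gcongr ?_ + _; exact hbound s hps hs1 h
    have h5 : ‖g θ - ∑' h : ℤ, γ h * fourier h θ‖ ≤ m / 2 := by
      rw [← h3.tsum_eq]
      refine (tsum_of_norm_bounded h4.hasSum fun h => ?_).trans hsm.le
      rw [← sub_mul, norm_mul, hn, mul_one]
      have : γ h * (s : ℂ) ^ (-h) - γ h = γ h * ((s ^ (-h) - 1 : ℝ) : ℂ) := by
        push_cast; ring
      rw [this, norm_mul, Complex.norm_real, Real.norm_eq_abs]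
    have h6 := (Complex.abs_re_le_norm _).trans h5
    rw [Complex.sub_re] at h6
    have := hpos θ
    have := (abs_le.1 h6).1
    linarith
  obtain ⟨u, hu0, hu⟩ := exists_hardy_solution (half_pos hm) hgre
  refine ⟨fun n => (s : ℂ) ^ n * inner ℂ (fourierLp 2 (n : ℤ)) u,
    ⟨‖u‖, s, hs0, hs1, fun n => ?_⟩, fun j => ?_⟩
  · rw [norm_mul, norm_pow, Complex.norm_real, Real.norm_of_nonneg hs0.le, mul_comm]
    gcongr
    refine (norm_inner_le_norm _ _).trans ?_
    rw [orthonormal_fourier.1, one_mul]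
  · have h1 : HasSum (fun h : ℤ => γ h * (s : ℂ) ^ (-h) * inner ℂ (fourierLp 2 ((j : ℤ) - h)) u)
        (if j = 0 then 1 else 0) := by
      rw [← hu j]
      have hL := ((innerSL ℂ (fourierLp 2 (j : ℤ))).comp
        (ContinuousLinearMap.apply ℂ _ u)).hasSum (circleMul.hasSum hgs.hasSum)
      convert! hL using 1
      ext h
      simp [inner_fourierLp_circleMul_fourier]
    have h2 := h1.mul_left ((s : ℂ) ^ (j : ℤ))
    have h3 : (s : ℂ) ^ (j : ℤ) * (if j = 0 then 1 else 0) = if j = 0 then 1 else 0 := by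
      split_ifs with h <;> simp [h]
    rw [h3, ← (Equiv.subLeft (j : ℤ)).hasSum_iff] at h2
    have h4 : Function.Injective (fun n : ℕ => (n : ℤ)) := Nat.cast_injective
    rw [← h4.hasSum_iff] at h2
    · convert! h2 using 1
      ext n
      simp only [Function.comp_apply, Equiv.subLeft_apply, sub_sub_cancel, neg_sub]
      rw [zpow_sub₀ hsC, zpow_natCast, zpow_natCast]
      field_simp
    · intro n hn
      have : n < 0 := by
        by_contra! h
        exact hn ⟨n.toNat, by simp [h]⟩
      simp [hu0 n this]

end Toeplitz

/-! ### Scalar innovations and vanishing of the long-run variance -/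

section Innovations

open ComplexConjugate

variable {𝓛 : Type*} [NormedAddCommGroup 𝓛] [InnerProductSpace ℂ 𝓛]

theorem HasSum.inner_prod {u v : ℕ → 𝓛} {U V : 𝓛} (hu : Summable fun n => ‖u n‖)
    (hv : Summable fun n => ‖v n‖) (hU : HasSum u U) (hV : HasSum v V) :
    HasSum (fun p : ℕ × ℕ => (inner ℂ (u p.1) (v p.2) : ℂ)) (inner ℂ U V) := by
  have hs : Summable fun p : ℕ × ℕ => (inner ℂ (u p.1) (v p.2) : ℂ) :=
    Summable.of_norm_bounded (hu.mul_of_nonneg hv (fun _ => norm_nonneg _) fun _ => norm_nonneg _)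
      fun p => norm_inner_le_norm _ _
  have h := hs.hasSum
  have h1 := h.prod_fiberwise fun n => (innerSL ℂ (u n)).hasSum hV
  have h2 := (innerSLFlip ℂ V).hasSum hU
  rwa [h1.unique h2] at h

/-- A sequence with exponentially decaying autocovariance function whose spectral density is bounded
from below is an invertible moving average of its orthogonal innovations. -/
theorem exists_innovation [CompleteSpace 𝓛] {y : ℤ → 𝓛} {γ : ℤ → ℂ} {K q m : ℝ} (hq0 : 0 < q)
    (hq1 : q < 1) (hγ : ∀ h, ‖γ h‖ ≤ K * q ^ h.natAbs) (hm : 0 < m)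
    (hpos : ∀ θ : UnitAddCircle, m ≤ (∑' h : ℤ, γ h * fourier h θ).re)
    (hy : ∀ s t, inner ℂ (y s) (y t) = γ (t - s)) :
    ∃ (a c : ℕ → ℂ) (ξ : ℤ → 𝓛) (σ : ℝ), ExpDecay a ∧ ExpDecay c ∧ c 0 = 1 ∧ 0 < σ ∧
      (∀ N, ∑ p ∈ Finset.HasAntidiagonal.antidiagonal N, c p.1 * a p.2 = if N = 0 then 1 else 0) ∧
      (∀ t : ℤ, HasSum (fun n : ℕ => a n • y (t - n)) (ξ t)) ∧
      ∀ s t, inner ℂ (ξ s) (ξ t) = if s = t then (σ : ℂ) else 0 := by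
  obtain ⟨a, ha, haγ⟩ := exists_wienerHopf_solution hq0 hq1 hγ hm hpos
  have hyn : ∀ t, ‖y t‖ ^ 2 = (γ 0).re := by
    intro t
    have := hy t t
    rw [sub_self] at this
    rw [← this]
    exact (inner_self_eq_norm_sq (𝕜 := ℂ) (y t)).symm
  have hyb : ∀ t, ‖y t‖ = ‖y 0‖ := fun t =>
    (sq_eq_sq₀ (norm_nonneg _) (norm_nonneg _)).1 ((hyn t).trans (hyn 0).symm)
  have hsum : ∀ t : ℤ, Summable fun n : ℕ => a n • y (t - n) := fun t =>
    Summable.of_norm (by simpa only [norm_smul, hyb] using ha.summable_norm.mul_right _)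
  choose η hη using hsum
  have hηs : ∀ (v : 𝓛) t, HasSum (fun n : ℕ => a n * inner ℂ v (y (t - n))) (inner ℂ v (η t)) := by
    intro v t
    simpa [inner_smul_right] using (innerSL ℂ v).hasSum (hη t)
  -- The Wiener-Hopf equation says that η_t is orthogonal to the strict past of y; it is a multiple
  -- of the one-step prediction error. Orthogonality of the η_t and ‖η_t‖² = a 0 follow.
  have h1 : ∀ (t : ℤ) (j : ℕ), inner ℂ (y (t - j)) (η t) = if j = 0 then 1 else 0 := by
    intro t j
    refine (hηs _ t).unique ?_
    convert! haγ j using 3 with n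
    rw [hy]
    congr 1
    ring
  have h2 : ∀ (t : ℤ) (j : ℕ), inner ℂ (η t) (η (t - j)) = if j = 0 then a 0 else 0 := by
    intro t j
    refine (hηs _ _).unique ?_
    have h3 : ∀ n : ℕ, a n * inner ℂ (η t) (y (t - j - n))
        = if n = 0 then (if j = 0 then a 0 else 0) else 0 := by
      intro n
      rw [← inner_conj_symm, show t - j - n = t - (j + n : ℕ) by push_cast; ring, h1]
      by_cases hn : n = 0 <;> by_cases hj : j = 0 <;> simp [hn, hj]
    simp_rw [h3]
    exact hasSum_ite_eq 0 _
  have h0 : ∀ t, (a 0) = ((‖η t‖ ^ 2 : ℝ) : ℂ) := by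
    intro t
    have := h2 t 0
    simp only [Nat.cast_zero, sub_zero, if_true] at this
    rw [← this, inner_self_eq_norm_sq_to_K]
    simp
  have hη0 : η 0 ≠ 0 := by
    intro h
    have := h1 0 0
    simp [h] at this
  set τ : ℝ := ‖η 0‖ ^ 2 with hτ
  have hτ0 : 0 < τ := by positivity
  have ha0 : a 0 = (τ : ℂ) := h0 0
  have hτC : (τ : ℂ) ≠ 0 := by exact_mod_cast hτ0.ne'
  let c : ℕ → ℂ := fun n => inner ℂ (η (-n)) (y 0)
  have hc : ∀ (t : ℤ) (n : ℕ), inner ℂ (η (t - n)) (y t) = c n := by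
    intro t n
    rw [← inner_conj_symm]
    simp only [c]
    rw [← inner_conj_symm (η (-n))]
    congr 1
    refine (hηs (y t) (t - n)).unique ?_
    convert! hηs (y 0) (-n) using 3 with m
    rw [hy, hy]
    congr 1
    ring
  have hcd : ExpDecay c := by
    have hK : 0 ≤ K := by simpa using (norm_nonneg _).trans (hγ 0)
    refine ⟨K * ∑' n, ‖a n‖, q, hq0, hq1, fun n => ?_⟩
    simp only [c]
    rw [norm_inner_symm, ← (hηs (y 0) (-n)).tsum_eq]
    have : HasSum (fun m => ‖a m‖ * (K * q ^ n)) ((∑' n, ‖a n‖) * (K * q ^ n)) :=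
      ha.summable_norm.hasSum.mul_right _
    refine (tsum_of_norm_bounded this fun m => ?_).trans_eq (by ring)
    rw [norm_mul, hy]
    refine mul_le_mul_of_nonneg_left ((hγ _).trans ?_) (norm_nonneg _)
    refine mul_le_mul_of_nonneg_left (pow_le_pow_of_le_one hq0.le hq1.le ?_) hK
    omega
  -- Both sides are ⟨η_{-N}, η_0⟩; terms with k > N vanish because η_{-N} is orthogonal to the
  -- strict past. Dividing a and η by τ = a 0 makes c the inverse power series of a, with c 0 = 1
  -- and innovation variance 1 / τ.
  have hconv : ∀ N : ℕ, ∑ k ∈ Finset.range (N + 1), a k * c (N - k)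
      = if N = 0 then (τ : ℂ) else 0 := by
    intro N
    have e1 : HasSum (fun k : ℕ => a k * inner ℂ (η (0 - N)) (y (0 - k)))
        (if N = 0 then (τ : ℂ) else 0) := by
      convert! hηs (η (0 - N)) 0 using 1
      rw [← inner_conj_symm, h2]
      split_ifs <;> simp [ha0]
    have e2 := hasSum_sum_of_ne_finset_zero (L := .unconditional ℕ) (s := Finset.range (N + 1))
      (f := fun k : ℕ => a k * inner ℂ (η (0 - N)) (y (0 - k))) (fun k hk => by
        have hk' : N < k := by simpa using hk
        rw [← inner_conj_symm, show (0 - k : ℤ) = 0 - N - (k - N : ℕ) by omega, h1,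
          if_neg (by omega)]
        simp)
    rw [e1.unique e2]
    refine Finset.sum_congr rfl fun k hk => ?_
    have hk' : k ≤ N := by simpa [Nat.lt_succ_iff] using hk
    rw [show (0 - N : ℤ) = (0 - k) - (N - k : ℕ) by omega, hc]
  refine ⟨fun n => (τ : ℂ)⁻¹ * a n, c, fun t => (τ : ℂ)⁻¹ • η t, τ⁻¹, ?_, hcd, ?_,
    inv_pos.2 hτ0, fun N => ?_, fun t => ?_, fun s t => ?_⟩
  · exact ha.of_norm_le ‖(τ : ℂ)⁻¹‖ (norm_nonneg _) fun n => (norm_mul _ _).le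
  · have := hconv 0
    simp only [zero_add, Finset.range_one, Finset.sum_singleton, Nat.sub_zero, if_true, ha0] at this
    exact mul_left_cancel₀ hτC (this.trans (mul_one _).symm)
  · have e1 : ∑ p ∈ Finset.HasAntidiagonal.antidiagonal N, c p.1 * ((τ : ℂ)⁻¹ * a p.2)
        = (τ : ℂ)⁻¹ * ∑ k ∈ Finset.range (N + 1), a k * c (N - k) := by
      rw [← Finset.Nat.sum_antidiagonal_eq_sum_range_succ (fun i j => a i * c j),
        ← Finset.Nat.sum_antidiagonal_swap, Finset.mul_sum]
      refine Finset.sum_congr rfl fun p _ => ?_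
      simp only [Prod.fst_swap, Prod.snd_swap]
      ring
    rw [e1, hconv]
    split_ifs <;> simp [hτC]
  · simpa only [smul_smul] using (hη t).const_smul ((τ : ℂ)⁻¹)
  · have key : ∀ (t : ℤ) (j : ℕ), inner ℂ ((τ : ℂ)⁻¹ • η t) ((τ : ℂ)⁻¹ • η (t - j))
        = if j = 0 then ((τ⁻¹ : ℝ) : ℂ) else 0 := by
      intro t j
      rw [inner_smul_left, inner_smul_right, h2]
      split_ifs
      · rw [ha0]; simp [hτC]
      · simp
    rcases le_total s t with h | h
    · obtain ⟨j, hj⟩ := Int.eq_ofNat_of_zero_le (sub_nonneg.2 h)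
      obtain rfl : s = t - j := by omega
      rw [← inner_conj_symm, key]
      by_cases hj0 : j = 0 <;> simp [hj0]
    · obtain ⟨j, hj⟩ := Int.eq_ofNat_of_zero_le (sub_nonneg.2 h)
      obtain rfl : t = s - j := by omega
      rw [key]
      have : s = s - j ↔ j = 0 := by omega
      simp [this]

/-- A stationary sequence of random linear maps with orthogonal ranges. -/
structure IsOrthNoise {D : Type*} [NormedAddCommGroup D] [NormedSpace ℂ D]
    (X : ℤ → D →L[ℂ] 𝓛) : Prop where
  orth : ∀ s t, s ≠ t → ∀ f g, inner ℂ (X s f) (X t g) = 0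
  stat : ∀ s t f g, inner ℂ (X s f) (X s g) = inner ℂ (X t f) (X t g)

variable {D : Type*} [NormedAddCommGroup D] [NormedSpace ℂ D] {X : ℤ → D →L[ℂ] 𝓛}

theorem IsOrthNoise.norm_apply (hX : IsOrthNoise X) (t : ℤ) (f : D) : ‖X t f‖ = ‖X 0 f‖ := by
  rw [@norm_eq_sqrt_re_inner ℂ, @norm_eq_sqrt_re_inner ℂ, hX.stat t 0]

theorem IsOrthNoise.norm_apply_le (hX : IsOrthNoise X) (t : ℤ) (f : D) :
    ‖X t f‖ ≤ ‖X 0‖ * ‖f‖ := by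
  rw [hX.norm_apply]; exact (X 0).le_opNorm f

theorem IsOrthNoise.summable_norm (hX : IsOrthNoise X) {φ : ℕ → D} (hφ : ExpDecay φ) (t : ℤ) :
    Summable fun n : ℕ => ‖X (t - n) (φ n)‖ :=
  Summable.of_nonneg_of_le (fun _ => norm_nonneg _) (fun _ => hX.norm_apply_le _ _)
    (hφ.summable_norm.mul_left _)

/-- The spectral density of y at z is ‖∑ zⁿ X_0 φ_n‖². It is continuous and, by hypothesis, positive
on the compact circle, so it has a positive lower bound. -/
theorem IsOrthNoise.exists_innovation [CompleteSpace 𝓛] (hX : IsOrthNoise X) {φ : ℕ → D}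
    (hφ : ExpDecay φ) (hpos : ∀ z : ℂ, ‖z‖ = 1 → ∑' n, z ^ n • X 0 (φ n) ≠ 0) {y : ℤ → 𝓛}
    (hy : ∀ t, HasSum (fun n : ℕ => X (t - n) (φ n)) (y t)) :
    ∃ (a c : ℕ → ℂ) (ξ : ℤ → 𝓛) (σ : ℝ), ExpDecay a ∧ ExpDecay c ∧ c 0 = 1 ∧ 0 < σ ∧
      (∀ N, ∑ p ∈ Finset.HasAntidiagonal.antidiagonal N, c p.1 * a p.2 = if N = 0 then 1 else 0) ∧
      (∀ t : ℤ, HasSum (fun n : ℕ => a n • y (t - n)) (ξ t)) ∧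
      ∀ s t, inner ℂ (ξ s) (ξ t) = if s = t then (σ : ℂ) else 0 := by
  set ψ : ℕ → 𝓛 := fun n => X 0 (φ n) with hψdef
  have hψ : ExpDecay ψ := hφ.of_norm_le ‖X 0‖ (norm_nonneg _) fun _ => (X 0).le_opNorm _
  have hF : ∀ s t : ℤ, HasSum (fun p : ℕ × ℕ =>
      if (p.2 : ℤ) - p.1 = t - s then (inner ℂ (ψ p.1) (ψ p.2) : ℂ) else 0)
      (inner ℂ (y s) (y t)) := by
    intro s t
    have := HasSum.inner_prod (hX.summable_norm hφ s) (hX.summable_norm hφ t) (hy s) (hy t)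
    convert! this using 1
    ext p
    split_ifs with h
    · rw [show s - (p.1 : ℤ) = t - p.2 by omega, hX.stat (t - p.2) 0]
    · rw [hX.orth _ _ (by omega)]
  set γ : ℤ → ℂ := fun h => inner ℂ (y 0) (y h) with hγdef
  have hyγ : ∀ s t, inner ℂ (y s) (y t) = γ (t - s) := by
    intro s t
    refine (hF s t).unique ?_
    simpa using hF 0 (t - s)
  obtain ⟨K, q, hq0, hq1, hK⟩ := hψ
  have hψs : Summable fun n => ‖ψ n‖ := ExpDecay.summable_norm ⟨K, q, hq0, hq1, hK⟩
  have hK0 : 0 ≤ K := by simpa using (norm_nonneg _).trans (hK 0)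
  -- In q^(m+n) = r^(m+n) · r^m r^n the first factor is at most r^|h| when n - m = h, and the second
  -- is summable over all pairs.
  set r := Real.sqrt q with hr
  have hr0 : 0 < r := Real.sqrt_pos.2 hq0
  have hr1 : r < 1 := by rw [hr, Real.sqrt_lt' one_pos]; simpa using hq1
  have hrr : r * r = q := Real.mul_self_sqrt hq0.le
  have hgeo := summable_geometric_of_lt_one hr0.le hr1
  have hgeo2 := (hgeo.mul_of_nonneg hgeo (fun n => by positivity)
    (fun n => by positivity)).hasSum
  have hγ : ∀ h : ℤ, ‖γ h‖ ≤ (K ^ 2 * ∑' p : ℕ × ℕ, r ^ p.1 * r ^ p.2) * r ^ h.natAbs := by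
    intro h
    simp only [hγdef]
    rw [← (hF 0 h).tsum_eq]
    refine (tsum_of_norm_bounded (hgeo2.mul_left (K ^ 2 * r ^ h.natAbs)) fun p => ?_).trans_eq
      (by ring)
    split_ifs with hp
    · have h1 : r ^ (p.1 + p.2) ≤ r ^ h.natAbs := pow_le_pow_of_le_one hr0.le hr1.le (by omega)
      calc ‖(inner ℂ (ψ p.1) (ψ p.2) : ℂ)‖ ≤ ‖ψ p.1‖ * ‖ψ p.2‖ := norm_inner_le_norm _ _
        _ ≤ (K * q ^ p.1) * (K * q ^ p.2) := by gcongr <;> exact hK _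
        _ = K ^ 2 * r ^ (p.1 + p.2) * (r ^ p.1 * r ^ p.2) := by
          rw [← hrr, mul_pow, mul_pow, pow_add]; ring
        _ ≤ _ := by gcongr
    · rw [norm_zero]; positivity
  -- The squared norm is expanded as a double series and grouped along the diagonals p.2 - p.1 = h.
  have hsym : ∀ θ : UnitAddCircle, ∑' h : ℤ, γ h * fourier h θ
      = ((‖∑' n : ℕ, (fourier (n : ℤ) θ : ℂ) • ψ n‖ ^ 2 : ℝ) : ℂ) := by
    intro θ
    have hn : ∀ h : ℤ, ‖(fourier h θ : ℂ)‖ = 1 := fun h => by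
      rw [fourier_apply]; exact Circle.norm_coe _
    have hs1 : Summable fun n : ℕ => ‖(fourier (n : ℤ) θ : ℂ) • ψ n‖ := by
      simpa only [norm_smul, hn, one_mul] using hψs
    have hs2 := HasSum.inner_prod hs1 hs1 hs1.of_norm.hasSum hs1.of_norm.hasSum
    rw [inner_self_eq_norm_sq_to_K] at hs2
    let f : ℕ × ℕ → ℤ := fun p => (p.2 : ℤ) - p.1
    have hs3 := (Equiv.sigmaFiberEquiv f).hasSum_iff.2 hs2
    have hs4 := hs3.sigma (g := fun h => γ h * fourier h θ) fun h => by
      have h5 := (hF 0 h).mul_right (fourier h θ : ℂ)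
      rw [sub_zero] at h5
      have h6 : HasSum (({p | f p = h} : Set (ℕ × ℕ)).indicator fun p =>
          (inner ℂ ((fourier (p.1 : ℤ) θ : ℂ) • ψ p.1) ((fourier (p.2 : ℤ) θ : ℂ) • ψ p.2) : ℂ))
          (γ h * fourier h θ) := by
        convert! h5 using 1
        ext p
        by_cases hp : (p.2 : ℤ) - p.1 = h
        · rw [Set.indicator_of_mem (by exact hp), if_pos hp, inner_smul_left, inner_smul_right,
            ← hp, sub_eq_add_neg, fourier_add, fourier_neg]
          ring
        · rw [Set.indicator_of_notMem (by exact hp), if_neg hp, zero_mul]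
      exact hasSum_subtype_iff_indicator.2 h6
    rw [hs4.tsum_eq]
    simp
  have hcont : Continuous fun θ : UnitAddCircle => ‖∑' n : ℕ, (fourier (n : ℤ) θ : ℂ) • ψ n‖ ^ 2 := by
    refine (Continuous.norm ?_).pow 2
    refine continuous_tsum (fun n => by fun_prop) hψs fun n θ => ?_
    rw [norm_smul, fourier_apply, Circle.norm_coe, one_mul]
  obtain ⟨θ₀, -, hθ₀⟩ := isCompact_univ.exists_isMinOn Set.univ_nonempty hcont.continuousOn
  have hm : 0 < ‖∑' n : ℕ, (fourier (n : ℤ) θ₀ : ℂ) • ψ n‖ ^ 2 := by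
    have h1 : ∀ n : ℕ, (fourier (n : ℤ) θ₀ : ℂ) = (fourier 1 θ₀ : ℂ) ^ n := by
      intro n
      induction n with
      | zero => simp
      | succ n ih => rw [pow_succ, ← ih, Nat.cast_succ, fourier_add]
    have h2 := hpos (fourier 1 θ₀ : ℂ) (by rw [fourier_apply]; exact Circle.norm_coe _)
    simp_rw [← h1] at h2
    exact pow_pos (norm_pos_iff.2 h2) 2
  refine _root_.exists_innovation hr0 hr1 hγ hm (fun θ => ?_) hyγ
  rw [hsym, Complex.ofReal_re]
  exact hθ₀ (Set.mem_univ θ)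

theorem IsOrthNoise.norm_sum_sq (hX : IsOrthNoise X) (f : D) (N : ℕ) :
    ‖∑ t ∈ Finset.range N, X (t + 1) f‖ ^ 2 = N * ‖X 0 f‖ ^ 2 := by
  induction N with
  | zero => simp
  | succ N ih =>
    have h0 : inner ℂ (∑ t ∈ Finset.range N, X (t + 1) f) (X (N + 1) f) = 0 := by
      rw [sum_inner]
      refine Finset.sum_eq_zero fun t ht => hX.orth _ _ ?_ _ _
      have := Finset.mem_range.1 ht
      omega
    rw [Finset.sum_range_succ, sq, norm_add_sq_eq_norm_sq_add_norm_sq_of_inner_eq_zero _ _ h0,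
      ← sq, ← sq, ih,
      hX.norm_apply (N + 1)]
    push_cast
    ring

/-- If a moving average is the difference of a bounded process, then its long-run variance is
zero. -/
theorem IsOrthNoise.apply_sum_eq_zero [CompleteSpace 𝓛] (hX : IsOrthNoise X) {φ : ℕ → D}
    (hφ : ExpDecay φ) {s : D} (hs : HasSum φ s) {U : ℤ → 𝓛} {M : ℝ} (hU : ∀ t, ‖U t‖ ≤ M)
    (hφU : ∀ t, HasSum (fun n : ℕ => X (t - n) (φ n)) (U t - U (t - 1))) : X 0 s = 0 := by
  -- Beveridge-Nelson decomposition: φ(z) = s + (1 - z) χ(z), so U - χ(L)X is a bounded process with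
  -- increments X_t s. Partial sums of these orthogonal increments have squared norm N ‖X_0 s‖²,
  -- which stays bounded only if X_0 s = 0.
  let χ : ℕ → D := fun n => ∑ i ∈ Finset.range (n + 1), φ i - s
  have hχ : ExpDecay χ := by
    obtain ⟨K, q, hq0, hq1, hK⟩ := hφ
    refine ⟨K * q / (1 - q), q, hq0, hq1, fun n => ?_⟩
    have h1 : HasSum (fun i => φ (i + (n + 1))) (s - ∑ i ∈ Finset.range (n + 1), φ i) :=
      (hasSum_nat_add_iff' (n + 1)).2 hs
    simp only [χ]
    rw [norm_sub_rev, ← h1.tsum_eq]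
    have h2 := (hasSum_geometric_of_lt_one hq0.le hq1).mul_left (K * q ^ (n + 1))
    refine (tsum_of_norm_bounded h2 fun i => ?_).trans_eq ?_
    · refine (hK _).trans_eq ?_
      rw [pow_add]; ring
    · rw [pow_succ]; ring
  choose G hsum using fun t => (hX.summable_norm hχ t).of_norm
  have hGb : ∀ t, ‖G t‖ ≤ ‖X 0‖ * ∑' n, ‖χ n‖ := fun t => by
    rw [← (hsum t).tsum_eq]
    exact tsum_of_norm_bounded (hχ.summable_norm.hasSum.mul_left _) fun n => hX.norm_apply_le _ _
  have hdiff : ∀ t, (U t - G t) - (U (t - 1) - G (t - 1)) = X t s := by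
    intro t
    have h1 := (hasSum_nat_add_iff' 1).2 (hsum t)
    have h2 := h1.sub (hsum (t - 1))
    have h3 := (hasSum_nat_add_iff' 1).2 (hφU t)
    have h4 : (fun n : ℕ => X (t - (n + 1 : ℕ)) (χ (n + 1)) - X (t - 1 - n) (χ n))
        = fun n : ℕ => X (t - (n + 1 : ℕ)) (φ (n + 1)) := by
      ext n
      rw [show t - 1 - (n : ℤ) = t - (n + 1 : ℕ) by push_cast; ring, ← map_sub]
      congr 1
      simp only [χ]
      rw [Finset.sum_range_succ _ (n + 1)]
      abel
    rw [h4] at h2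
    have h5 := h2.unique h3
    simp only [Finset.range_one, Finset.sum_singleton, Nat.cast_zero, sub_zero, χ, zero_add,
      map_sub] at h5
    have h6 : (U t - G t) - (U (t - 1) - G (t - 1)) = (U t - U (t - 1) - X t (φ 0)) -
      (G t - (X t (φ 0) - X t s) - G (t - 1)) + X t s := by abel
    rw [h6, h5, sub_self, zero_add]
  have htel : ∀ N : ℕ, ∑ t ∈ Finset.range N, X (t + 1) s = (U N - G N) - (U 0 - G 0) := by
    intro N
    have := Finset.sum_range_sub (fun n : ℕ => U n - G n) N
    rw [Nat.cast_zero] at this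
    rw [← this]
    refine Finset.sum_congr rfl fun t _ => ?_
    rw [← hdiff, add_sub_cancel_right]
    simp
  set B := M + ‖X 0‖ * ∑' n, ‖χ n‖
  have hWb : ∀ t, ‖U t - G t‖ ≤ B := fun t =>
    (norm_sub_le _ _).trans (add_le_add (hU t) (hGb t))
  have hfin : ∀ N : ℕ, N * ‖X 0 s‖ ^ 2 ≤ (B + B) ^ 2 := by
    intro N
    rw [← hX.norm_sum_sq, htel]
    gcongr
    exact (norm_sub_le _ _).trans (add_le_add (hWb _) (hWb _))
  by_contra hne
  have hp : 0 < ‖X 0 s‖ ^ 2 := pow_pos (norm_pos_iff.2 hne) 2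
  obtain ⟨N, hN⟩ := exists_nat_gt ((B + B) ^ 2 / ‖X 0 s‖ ^ 2)
  rw [div_lt_iff₀ hp] at hN
  exact absurd (hfin N) (not_le.2 hN)

end Innovations

/-! ### Second-order theory of white noise in L² -/

section SecondOrder

open Filter Topology ComplexConjugate

variable {Ω : Type*} [MeasurableSpace Ω] {P : Measure Ω}

/-- The sum in `L²` of a series agrees with its almost sure sum. -/
theorem Lp_ae_eq_of_hasSum {E : Type*} [NormedAddCommGroup E] {f : ℕ → Lp E 2 P} {F : Lp E 2 P}
    (hF : HasSum f F) {g : Ω → E} (hg : ∀ᵐ ω ∂P, HasSum (fun n => f n ω) (g ω)) : F =ᵐ[P] g := by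
  have h1 : Tendsto (fun N => ∑ n ∈ Finset.range N, f n) atTop (𝓝 F) := hF.tendsto_sum_nat
  obtain ⟨ns, hns, h2⟩ := (tendstoInMeasure_of_tendsto_Lp h1).exists_seq_tendsto_ae
  have h3 : ∀ᵐ ω ∂P, ∀ N, (∑ n ∈ Finset.range N, f n) ω = ∑ n ∈ Finset.range N, f n ω :=
    ae_all_iff.2 fun N => by
      induction N with
      | zero =>
        filter_upwards [Lp.coeFn_zero E 2 P] with ω h
        simpa using h
      | succ N ih =>
        rw [Finset.sum_range_succ]
        filter_upwards [ih, Lp.coeFn_add (∑ n ∈ Finset.range N, f n) (f N)] with ω h h'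
        rw [h', Pi.add_apply, h, Finset.sum_range_succ]
  filter_upwards [h2, h3, hg] with ω h2 h3 hg
  refine tendsto_nhds_unique h2 ?_
  simp_rw [h3]
  exact hg.tendsto_sum_nat.comp hns.tendsto_atTop

variable {E : Type*} [NormedAddCommGroup E] [InnerProductSpace ℂ E]

/-- The linear map sending a functional `ℓ` to the class of `ℓ (e ω)` in `L²`. -/
def functionalMap (e : Lp E 2 P) : (E →L[ℂ] ℂ) →L[ℂ] Lp ℂ 2 P :=
  (ContinuousLinearMap.compLpL₂ 2 P (ContinuousLinearMap.id ℂ (E →L[ℂ] ℂ))).flip e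

theorem coeFn_functionalMap (e : Lp E 2 P) (ℓ : E →L[ℂ] ℂ) :
    functionalMap e ℓ =ᵐ[P] fun ω => ℓ (e ω) :=
  ContinuousLinearMap.coeFn_compLp ℓ e

variable [MeasurableSpace E]

/-- The functionals of white noise as elements of `L²`. -/
def IsWhiteNoise.toLpMap {ε : ℤ → Ω → E} (hε : IsWhiteNoise P ε) (t : ℤ) :
    (E →L[ℂ] ℂ) →L[ℂ] Lp ℂ 2 P :=
  functionalMap (hε.memLp t).toLp

theorem IsWhiteNoise.coeFn_toLpMap {ε : ℤ → Ω → E} (hε : IsWhiteNoise P ε) (t : ℤ)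
    (ℓ : E →L[ℂ] ℂ) : hε.toLpMap t ℓ =ᵐ[P] fun ω => ℓ (ε t ω) := by
  filter_upwards [coeFn_functionalMap (hε.memLp t).toLp ℓ, (hε.memLp t).coeFn_toLp] with ω h h'
  rw [← h']
  exact h

theorem IsWhiteNoise.inner_toLpMap [CompleteSpace E] {ε : ℤ → Ω → E} (hε : IsWhiteNoise P ε)
    (s t : ℤ) (f g : E →L[ℂ] ℂ) :
    inner ℂ (hε.toLpMap s f) (hε.toLpMap t g) = crossCov P (ε t) (ε s)
      ((InnerProductSpace.toDual ℂ E).symm g) ((InnerProductSpace.toDual ℂ E).symm f) := by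
  rw [L2.inner_def, crossCov]
  refine integral_congr_ae ?_
  filter_upwards [hε.coeFn_toLpMap s f, hε.coeFn_toLpMap t g] with ω h h'
  rw [h, h', hε.mean_zero, hε.mean_zero, sub_zero, sub_zero, RCLike.inner_apply,
    InnerProductSpace.toDual_symm_apply]
  congr 1
  rw [← inner_conj_symm, InnerProductSpace.toDual_symm_apply]

theorem IsWhiteNoise.isOrthNoise [CompleteSpace E] {ε : ℤ → Ω → E} (hε : IsWhiteNoise P ε) :
    IsOrthNoise hε.toLpMap where
  orth s t hst f g := by rw [hε.inner_toLpMap, hε.crossCov_zero s t hst]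
  stat s t f g := by
    rw [hε.inner_toLpMap, hε.inner_toLpMap, hε.crossCov_shift s s (t - s), add_sub_cancel]

/-- The point where positive definiteness of the covariance operator enters; both directions of the
cointegration criterion depend on it. -/
theorem IsWhiteNoise.toLpMap_ne_zero [CompleteSpace E] {ε : ℤ → Ω → E} (hε : IsWhiteNoise P ε)
    (hpos : ∀ v : E, v ≠ 0 → 0 < ∫ ω, ‖(inner ℂ v (ε 0 ω) : ℂ)‖ ^ 2 ∂P) {f : E →L[ℂ] ℂ}
    (hf : f ≠ 0) : hε.toLpMap 0 f ≠ 0 := by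
  intro h0
  have h1 := hpos ((InnerProductSpace.toDual ℂ E).symm f) (by simpa using hf)
  refine h1.ne' ?_
  rw [integral_eq_zero_of_ae]
  have h2 := hε.coeFn_toLpMap 0 f
  rw [h0] at h2
  filter_upwards [h2, Lp.coeFn_zero ℂ 2 P] with ω h h'
  rw [InnerProductSpace.toDual_symm_apply, ← h, h']
  simp

/-- A moving average of white noise converges in `L²`. -/
theorem IsWhiteNoise.exists_hasSum_Lp [CompleteSpace E] {ε : ℤ → Ω → E} (hε : IsWhiteNoise P ε)
    {φ : ℕ → E →L[ℂ] ℂ} (hφ : ExpDecay φ) {w : ℤ → Ω → ℂ} (hw : IsFilter P φ ε w) :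
    ∃ Y : ℤ → Lp ℂ 2 P, (∀ t, Y t =ᵐ[P] w t) ∧
      (∀ t, ‖Y t‖ ≤ ‖hε.toLpMap 0‖ * ∑' n, ‖φ n‖) ∧
      ∀ t, HasSum (fun n : ℕ => hε.toLpMap (t - n) (φ n)) (Y t) := by
  choose Y hY using fun t => (hε.isOrthNoise.summable_norm hφ t).of_norm
  refine ⟨Y, fun t => ?_, fun t => ?_, hY⟩
  · refine Lp_ae_eq_of_hasSum (hY t) ?_
    have h1 := ae_all_iff.2 fun n : ℕ => hε.coeFn_toLpMap (t - n) (φ n)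
    filter_upwards [h1, hw t] with ω h1 h2
    simpa only [h1] using h2
  · rw [← (hY t).tsum_eq]
    exact tsum_of_norm_bounded (hφ.summable_norm.hasSum.mul_left _)
      fun n => hε.isOrthNoise.norm_apply_le _ _

/-- An orthogonal sequence of centred square integrable random variables of equal variance is
white noise. -/
theorem isWhiteNoise_of_inner {ξ : ℤ → Lp ℂ 2 P} {σ : ℝ} (hσ : 0 < σ)
    (hξ : ∀ s t, inner ℂ (ξ s) (ξ t) = if s = t then (σ : ℂ) else 0)
    (h0 : ∀ t, ∫ ω, ξ t ω ∂P = 0) : IsWhiteNoise P fun t => (ξ t : Ω → ℂ) := by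
  have hsq : ∀ t, ∫ ω, (‖ξ t ω‖ ^ 2 : ℝ) ∂P = σ := by
    intro t
    have h1 := hξ t t
    rw [if_pos rfl, L2.inner_def] at h1
    have h2 : ∀ ω, (inner ℂ (ξ t ω) (ξ t ω) : ℂ) = ((‖ξ t ω‖ ^ 2 : ℝ) : ℂ) := fun ω => by
      rw [inner_self_eq_norm_sq_to_K]; simp
    simp_rw [h2] at h1
    rw [integral_complex_ofReal] at h1
    exact_mod_cast h1
  have hcc : ∀ s t v w, crossCov P (ξ t) (ξ s) v w = conj v * w * if s = t then (σ : ℂ) else 0 := by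
    intro s t v w
    rw [crossCov, ← hξ, L2.inner_def, ← integral_const_mul]
    refine integral_congr_ae (ae_of_all _ fun ω => ?_)
    simp only [h0, sub_zero, RCLike.inner_apply]
    ring
  have hcov : ∀ t, covOperator P (ξ t) = fun w => w * (σ : ℂ) := by
    intro t
    ext w
    rw [covOperator, ← hsq t, ← integral_complex_ofReal, ← integral_const_mul]
    refine integral_congr_ae (ae_of_all _ fun ω => ?_)
    simp only [RCLike.inner_apply, smul_eq_mul]
    rw [mul_assoc, RCLike.conj_mul]
    simp
  exact
    { measurable := fun t => (Lp.stronglyMeasurable (ξ t)).measurable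
      memLp := fun t => Lp.memLp (ξ t)
      pos := fun t => by rw [hsq]; exact hσ
      mean_eq := fun s t => by rw [h0, h0]
      covOperator_eq := fun s t => by rw [hcov, hcov]
      crossCov_shift := fun s t u v w => by simp [hcc]
      mean_zero := h0
      crossCov_zero := fun s t hst v w => by rw [hcc, if_neg hst, mul_zero] }

variable [IsProbabilityMeasure P]

theorem momentBound_of_norm_le {ξ : ℤ → Lp ℂ 2 P} {M : ℝ} (hM : ∀ t, ‖ξ t‖ ≤ M) :
    MomentBound P fun t => (ξ t : Ω → ℂ) := by
  have hint : ∀ t, Integrable (ξ t) P := fun t => (Lp.memLp (ξ t)).integrable (by norm_num)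
  refine ⟨hint, fun r hr t => ⟨1 + M ^ 2, fun n => ?_⟩⟩
  have h2 : Integrable (fun ω => ‖ξ (t - n) ω‖ ^ 2) P :=
    (Lp.memLp (ξ (t - n))).integrable_norm_pow (by norm_num)
  have h3 : ∫ ω, ‖ξ (t - n) ω‖ ^ 2 ∂P = ‖ξ (t - n)‖ ^ 2 := by
    have h4 := @L2.inner_def Ω ℂ ℂ _ _ P _ _ (ξ (t - n)) (ξ (t - n))
    rw [inner_self_eq_norm_sq_to_K] at h4
    have h5 : ∀ ω, (inner ℂ (ξ (t - n) ω) (ξ (t - n) ω) : ℂ) = ((‖ξ (t - n) ω‖ ^ 2 : ℝ) : ℂ) :=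
      fun ω => by rw [inner_self_eq_norm_sq_to_K]; simp
    simp_rw [h5] at h4
    rw [integral_complex_ofReal] at h4
    refine Complex.ofReal_injective (h4.symm.trans ?_)
    simp
  have h6 := integral_mono (hint (t - n)).norm ((integrable_const (1 : ℝ)).add h2) (fun ω => by
    simp only [Pi.add_apply]
    nlinarith [sq_nonneg (‖ξ (t - n) ω‖ - 1), norm_nonneg (ξ (t - n) ω)])
  rw [integral_add' (integrable_const _) h2, h3] at h6
  simp only [integral_const, probReal_univ, smul_eq_mul, mul_one] at h6
  calc ∫ ω, ‖ξ (t - n) ω‖ ∂P ≤ 1 + ‖ξ (t - n)‖ ^ 2 := h6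
    _ ≤ 1 + M ^ 2 := by gcongr; exact hM _
    _ ≤ (1 + M ^ 2) * r ^ n := le_mul_of_one_le_right (by positivity) (one_le_pow₀ hr.le)

/-- A scalar moving average of white noise whose transfer function does not vanish on the unit
circle is integrated of order zero. -/
theorem IsWhiteNoise.isIntegratedZero_of_isFilter [CompleteSpace E] {ε : ℤ → Ω → E}
    (hε : IsWhiteNoise P ε)
    (hpos : ∀ v : E, v ≠ 0 → 0 < ∫ ω, ‖(inner ℂ v (ε 0 ω) : ℂ)‖ ^ 2 ∂P)
    {φ : ℕ → E →L[ℂ] ℂ} (hφ : ExpDecay φ) {G : ℂ → E →L[ℂ] ℂ}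
    (hG : ∀ z : ℂ, ‖z‖ ≤ 1 → HasSum (fun n => z ^ n • φ n) (G z))
    (hG0 : ∀ z : ℂ, ‖z‖ = 1 → G z ≠ 0) {w : ℤ → Ω → ℂ} (hwm : ∀ t, Measurable (w t))
    (hw : IsFilter P φ ε w) (hw0 : ∀ t, ∫ ω, w t ω ∂P = 0) : IsIntegratedZero P w := by
  obtain ⟨Y, hYw, hYb, hY⟩ := hε.exists_hasSum_Lp hφ hw
  obtain ⟨a, c, ξ, σ, ha, hc, hc0, hσ, hca, haξ, hξ⟩ := hε.isOrthNoise.exists_innovation hφ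
    (fun z hz => by
      have := (hε.toLpMap 0).hasSum (hG z hz.le)
      simp only [map_smul] at this
      rw [this.tsum_eq]
      exact hε.toLpMap_ne_zero hpos (hG0 z hz)) hY
  let a' : ℕ → ℂ →L[ℂ] ℂ := fun n => a n • ContinuousLinearMap.id ℂ ℂ
  let c' : ℕ → ℂ →L[ℂ] ℂ := fun n => c n • ContinuousLinearMap.id ℂ ℂ
  have hnorm : ∀ z : ℂ, ‖z • ContinuousLinearMap.id ℂ ℂ‖ ≤ 1 * ‖z‖ := fun z => by
    rw [norm_smul, ContinuousLinearMap.norm_id]; simp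
  have ha' : ExpDecay a' := ha.of_norm_le 1 zero_le_one fun n => hnorm _
  have hc' : ExpDecay c' := hc.of_norm_le 1 zero_le_one fun n => hnorm _
  have hYm := momentBound_of_norm_le hYb
  have hξb : ∀ t, ‖ξ t‖ ≤ Real.sqrt σ := by
    intro t
    have := hξ t t
    rw [if_pos rfl, inner_self_eq_norm_sq_to_K] at this
    refine Real.le_sqrt_of_sq_le (le_of_eq (Complex.ofReal_injective ?_))
    rw [← this]
    simp
  have hξm := momentBound_of_norm_le hξb
  obtain ⟨u, hu⟩ := hYm.exists_isFilter ha'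
  have hξu : ∀ t, ξ t =ᵐ[P] u t := fun t => by
    refine Lp_ae_eq_of_hasSum (haξ t) ?_
    filter_upwards [hu t, ae_all_iff.2 fun n : ℕ => Lp.coeFn_smul (a n) (Y (t - n))] with ω h1 h2
    simp only [h2]
    exact h1
  have hfa : IsFilter P a' (fun t => (Y t : Ω → ℂ)) fun t => (ξ t : Ω → ℂ) :=
    hu.congr fun t => (hξu t).symm
  have hξ0 : ∀ t, ∫ ω, ξ t ω ∂P = 0 := hfa.integral_eq_zero ha' hYm fun t => by
    rw [integral_congr_ae (hYw t), hw0]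
  obtain ⟨y, hy⟩ := hξm.exists_isFilter hc'
  have hconv : convCoeff c' a' = fun n => if n = 0 then ContinuousLinearMap.id ℂ ℂ else 0 := by
    ext1 N
    have h1 : convCoeff c' a' N = (∑ p ∈ Finset.HasAntidiagonal.antidiagonal N, c p.1 * a p.2) •
        ContinuousLinearMap.id ℂ ℂ := by
      ext
      simp only [convCoeff, a', c', sum_apply]
      simp [mul_comm]
    rw [h1, hca]
    split_ifs <;> simp
  have hid : IsFilter P (convCoeff c' a') (fun t => (Y t : Ω → ℂ)) fun t => (Y t : Ω → ℂ) := by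
    rw [hconv]
    refine fun t => ae_of_all _ fun ω => ?_
    have := hasSum_single (L := .unconditional ℕ)
      (f := fun n : ℕ => (if n = 0 then ContinuousLinearMap.id ℂ ℂ else 0) (Y (t - n) ω)) 0
      fun n hn => by simp [hn]
    simpa using this
  -- c(L) ξ = c(L) a(L) Y = Y, because c and a are inverse power series.
  have hfc : IsFilter P c' (fun t => (ξ t : Ω → ℂ)) w :=
    (hy.congr ((IsFilter.comp hc' ha' hYm hfa hy).unique hid)).congr hYw
  have hwi : ∀ t, Integrable (w t) P := fun t => (hYm.integrable t).congr (hYw t)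
  refine ⟨fun t => (ξ t : Ω → ℂ), c', ⟨isWhiteNoise_of_inner hσ hξ hξ0, hwm, hwi, ?_, ?_, ?_⟩, ?_⟩
  · simp only [c', hc0, one_smul]
  · obtain ⟨ρ, hρ, hs⟩ := hc'.exists_summable
    exact ⟨ρ, hρ, fun z hz => hs _ (norm_nonneg _) hz⟩
  · intro t
    simp only [hw0, sub_zero]
    exact hfc t
  -- Nonvanishing of c(1) follows from c(1) a(1) = 1.
  · have h1 : HasSum (fun n => (1 : ℂ) ^ n • convCoeff c' a' n) ((∑' n, c' n).comp (∑' n, a' n)) :=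
      hasSum_convCoeff hc' ha' (by simp) (by simpa using hc'.summable_norm.of_norm.hasSum)
        (by simpa using ha'.summable_norm.of_norm.hasSum)
    have h2 : HasSum (fun n => (1 : ℂ) ^ n • convCoeff c' a' n) (ContinuousLinearMap.id ℂ ℂ) := by
      rw [hconv]
      have := hasSum_ite_eq (0 : ℕ) (ContinuousLinearMap.id ℂ ℂ)
      simpa using this
    intro h0
    rw [h0, ContinuousLinearMap.zero_comp] at h1
    have h3 := congrArg (fun T : ℂ →L[ℂ] ℂ => T 1) (h1.unique h2)
    simp at h3

/-- If a difference of positive order of a process that is integrated of order zero is a moving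
average of white noise, then the long-run variance of the moving average is zero. -/
theorem IsIntegratedZero.toLpMap_eq_zero [CompleteSpace E] {u : ℤ → Ω → ℂ}
    (hu : IsIntegratedZero P u) {j : ℕ} {ε : ℤ → Ω → E} (hε : IsWhiteNoise P ε)
    {φ : ℕ → E →L[ℂ] ℂ} (hφ : ExpDecay φ) (hf : IsFilter P φ ε (diffOp^[j + 1] u))
    (h0 : ∀ t, ∫ ω, diffOp^[j + 1] u t ω ∂P = 0) {s : E →L[ℂ] ℂ} (hs : HasSum φ s) :
    hε.toLpMap 0 s = 0 := by
  obtain ⟨η, c, hlin, -⟩ := hu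
  have hc : ExpDecay c := by
    obtain ⟨ρ, hρ, hsum⟩ := hlin.abs_convergent
    obtain ⟨r, hr1, hrρ⟩ := exists_between hρ
    have hr0 : 0 < r := by linarith
    have h1 := hsum (r : ℂ) (by rwa [Complex.norm_real, Real.norm_of_nonneg hr0.le])
    rw [Complex.norm_real, Real.norm_of_nonneg hr0.le] at h1
    refine ⟨∑' n, ‖c n‖ * r ^ n, r⁻¹, inv_pos.2 hr0, inv_lt_one_of_one_lt₀ hr1, fun n => ?_⟩
    rw [inv_pow, ← div_eq_mul_inv, le_div_iff₀ (pow_pos hr0 n)]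
    exact h1.le_tsum n fun m _ => by positivity
  obtain ⟨Y, hYu, hYb, -⟩ := hlin.whiteNoise.exists_hasSum_Lp (φ := c) hc
    (w := fun t ω => u t ω - ∫ ω', u t ω' ∂P) hlin.eq_series
  -- Only u - E u is a moving average, so the differences of u are L²-bounded up to a deterministic
  -- term κ, which may depend on time. At order j + 1 it vanishes by comparing means.
  have key : ∀ i : ℕ, ∃ (U : ℤ → Lp ℂ 2 P) (M : ℝ) (κ : ℤ → ℂ), (∀ t, ‖U t‖ ≤ M) ∧
      (∀ t, ∫ ω, U t ω ∂P = 0) ∧ ∀ t, U t =ᵐ[P] fun ω => diffOp^[i] u t ω - κ t := by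
    intro i
    induction i with
    | zero =>
      refine ⟨Y, _, fun t => ∫ ω', u t ω' ∂P, hYb, fun t => ?_, hYu⟩
      rw [integral_congr_ae (hYu t), integral_sub (hlin.integrable t) (integrable_const _)]
      simp
    | succ i ih =>
      obtain ⟨U, M, κ, hM, hU0, hU⟩ := ih
      refine ⟨fun t => U t - U (t - 1), M + M, fun t => κ t - κ (t - 1), fun t => ?_, fun t => ?_,
        fun t => ?_⟩
      · exact (norm_sub_le _ _).trans (add_le_add (hM _) (hM _))
      · rw [integral_congr_ae (Lp.coeFn_sub _ _)]
        simp only [Pi.sub_apply]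
        rw [integral_sub ((Lp.memLp _).integrable (by norm_num))
          ((Lp.memLp _).integrable (by norm_num)), hU0, hU0, sub_zero]
      · filter_upwards [Lp.coeFn_sub (U t) (U (t - 1)), hU t, hU (t - 1)] with ω h1 h2 h3
        rw [h1, Pi.sub_apply, h2, h3, Function.iterate_succ_apply']
        simp only [diffOp]
        ring
  obtain ⟨U, M, κ, hM, hU0, hU⟩ := key j
  obtain ⟨W, hWf, -, hW⟩ := hε.exists_hasSum_Lp hφ hf
  refine hε.isOrthNoise.apply_sum_eq_zero hφ hs hM fun t => ?_
  suffices h : U t - U (t - 1) = W t by rw [h]; exact hW t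
  have h1 : (U t - U (t - 1) : Lp ℂ 2 P) =ᵐ[P] fun ω => W t ω - (κ t - κ (t - 1)) := by
    filter_upwards [Lp.coeFn_sub (U t) (U (t - 1)), hU t, hU (t - 1), hWf t] with ω h1 h2 h3 h4
    rw [h1, Pi.sub_apply, h2, h3, h4, Function.iterate_succ_apply']
    simp only [diffOp]
    ring
  have hκ : κ t - κ (t - 1) = 0 := by
    have h2 := integral_congr_ae h1
    rw [integral_sub ((Lp.memLp _).integrable (by norm_num)) (integrable_const _),
      integral_congr_ae (hWf t), h0, integral_congr_ae (Lp.coeFn_sub _ _)] at h2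
    simp only [Pi.sub_apply] at h2
    rw [integral_sub ((Lp.memLp _).integrable (by norm_num))
      ((Lp.memLp _).integrable (by norm_num)), hU0, hU0] at h2
    simp only [sub_self, integral_const, probReal_univ, one_smul] at h2
    linear_combination h2
  refine Lp.ext (h1.trans ?_)
  simp [hκ]

end SecondOrder

/-! ### Laurent coefficients and pole orders -/

section Main

open Filter Topology

theorem measurable_diffOp_iterate {Ω E : Type*} [MeasurableSpace Ω] [NormedAddCommGroup E]
    [InnerProductSpace ℂ E] [MeasurableSpace E] [BorelSpace E] [SecondCountableTopology E]
    {u : ℤ → Ω → E} (hu : ∀ t, Measurable (u t)) (b : ℕ) (t : ℤ) : Measurable (diffOp^[b] u t) := by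
  induction b generalizing t with
  | zero => exact hu t
  | succ b ih =>
    rw [Function.iterate_succ_apply']
    exact (ih t).sub (ih (t - 1))

theorem integrable_diffOp_iterate {Ω E : Type*} [MeasurableSpace Ω] {P : Measure Ω}
    [NormedAddCommGroup E] [InnerProductSpace ℂ E] {u : ℤ → Ω → E} (hu : ∀ t, Integrable (u t) P)
    (b : ℕ) (t : ℤ) : Integrable (diffOp^[b] u t) P := by
  induction b generalizing t with
  | zero => exact hu t
  | succ b ih =>
    rw [Function.iterate_succ_apply']
    exact (ih t).sub (ih (t - 1))

variable {H : Type*} [NormedAddCommGroup H] [InnerProductSpace ℂ H] [CompleteSpace H]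

/-- A holomorphic function `G` with `G(z) A(z) = (1 - z)^d` determines the Laurent expansion of
`A(z)⁻¹` at one. -/
theorem exists_laurentExpansion {k : ℕ} {a : Fin k → H →L[ℂ] H} {d : ℕ} {G : ℂ → H →L[ℂ] H} {ρ : ℝ}
    (hρ : 1 < ρ) (hG : DifferentiableOn ℂ G (Metric.ball 0 ρ)) (hG1 : G 1 ≠ 0)
    (hGA : ∀ z ∈ Metric.ball (0 : ℂ) ρ,
      (G z).comp (arPoly a z) = (1 - z) ^ d • ContinuousLinearMap.id ℂ H)
    (hunit : ∀ z ∈ Metric.ball (0 : ℂ) ρ, z ≠ 1 → IsUnit (arPoly a z)) :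
    ∃ C : ℕ → H →L[ℂ] H, C 0 = G 1 ∧ IsInverseLaurentExpansion a d C := by
  have hball : Metric.ball (0 : ℂ) ρ ∈ 𝓝 (1 : ℂ) :=
    Metric.isOpen_ball.mem_nhds (by simpa using hρ)
  obtain ⟨p, hp⟩ := hG.analyticAt hball
  have h1 := hasFPowerSeriesAt_iff'.1 hp
  have hC0 : p.coeff 0 = G 1 := hp.coeff_zero _
  -- The signs convert the Taylor series of G in `z - 1` into one in `1 - z`.
  refine ⟨fun n => (-1 : ℂ) ^ n • p.coeff n, by simpa using hC0, by simpa [hC0] using hG1, ?_⟩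
  obtain ⟨δ, hδ, h2⟩ := Metric.eventually_nhds_iff.1 (h1.and hball)
  refine ⟨δ, hδ, fun z hz hzδ => ?_⟩
  obtain ⟨h3, h4⟩ := h2 (by rwa [dist_eq_norm])
  have hz' : 1 - z ≠ 0 := sub_ne_zero.2 hz.symm
  have hu := hunit z h4 hz
  have h5 : Ring.inverse (arPoly a z) = (1 - z) ^ (-(d : ℤ)) • G z := by
    have h6 : G z * arPoly a z = (1 - z) ^ d • (1 : H →L[ℂ] H) := hGA z h4
    have h7 : G z = (1 - z) ^ d • Ring.inverse (arPoly a z) := by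
      have := congrArg (· * Ring.inverse (arPoly a z)) h6
      simpa only [mul_assoc, Ring.mul_inverse_cancel _ hu, mul_one, smul_mul_assoc, one_mul]
        using this
    rw [h7, smul_smul, zpow_neg, zpow_natCast, inv_mul_cancel₀ (pow_ne_zero _ hz'), one_smul]
  rw [h5]
  convert! h3.const_smul ((1 - z) ^ (-(d : ℤ))) using 1
  ext1 n
  rw [smul_smul, smul_smul, sub_eq_add_neg (n : ℤ), zpow_add₀ hz', zpow_natCast,
    show z - 1 = (-1) * (1 - z) by ring, mul_pow]
  congr 1
  ring

/-- The leading Laurent coefficient of `A(z)⁻¹` maps into the kernel of `A(1)`. -/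
theorem arPoly_one_comp_eq_zero {k : ℕ} {a : Fin k → H →L[ℂ] H} {d : ℕ} (hd : 1 ≤ d)
    {G : ℂ → H →L[ℂ] H} {ρ : ℝ} (hρ : 1 < ρ) (hG : DifferentiableOn ℂ G (Metric.ball 0 ρ))
    (hGA : ∀ z ∈ Metric.ball (0 : ℂ) ρ,
      (G z).comp (arPoly a z) = (1 - z) ^ d • ContinuousLinearMap.id ℂ H)
    (hunit : ∀ z ∈ Metric.ball (0 : ℂ) ρ, z ≠ 1 → IsUnit (arPoly a z)) :
    (arPoly a 1).comp (G 1) = 0 := by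
  have hball : Metric.ball (0 : ℂ) ρ ∈ 𝓝 (1 : ℂ) :=
    Metric.isOpen_ball.mem_nhds (by simpa using hρ)
  have h1 : Tendsto (fun z => (arPoly a z).comp (G z)) (𝓝[≠] (1 : ℂ))
      (𝓝 ((arPoly a 1).comp (G 1))) :=
    ((differentiable_arPoly a).continuous.continuousAt.clm_comp
      (hG.differentiableAt hball).continuousAt).tendsto.mono_left nhdsWithin_le_nhds
  have h2 : Tendsto (fun z : ℂ => (1 - z) ^ d • (1 : H →L[ℂ] H)) (𝓝[≠] (1 : ℂ))
      (𝓝 ((1 - 1 : ℂ) ^ d • (1 : H →L[ℂ] H))) :=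
    ((by fun_prop : Continuous fun z : ℂ => (1 - z) ^ d • (1 : H →L[ℂ] H)).tendsto 1).mono_left
      nhdsWithin_le_nhds
  rw [sub_self, zero_pow (by omega), zero_smul] at h2
  refine tendsto_nhds_unique h1 (h2.congr' ?_)
  filter_upwards [mem_nhdsWithin_of_mem_nhds hball, self_mem_nhdsWithin] with z hz hz1
  have hu := hunit z hz hz1
  have h6 : G z * arPoly a z = (1 - z) ^ d • (1 : H →L[ℂ] H) := hGA z hz
  apply hu.mul_right_cancel
  change _ = (arPoly a z * G z) * arPoly a z
  rw [mul_assoc, h6]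
  simp

/-- The pole of `V A(z)⁻¹` has smaller order than that of `A(z)⁻¹` if `V` annihilates the leading
coefficient. -/
theorem regularization_exponent_lt {k : ℕ} {a : Fin k → H →L[ℂ] H} {d b : ℕ}
    {G : ℂ → H →L[ℂ] H} {ρ ρ' : ℝ} (hρ : 1 < ρ) (hG : DifferentiableOn ℂ G (Metric.ball 0 ρ))
    (hGA : ∀ z ∈ Metric.ball (0 : ℂ) ρ,
      (G z).comp (arPoly a z) = (1 - z) ^ d • ContinuousLinearMap.id ℂ H)
    (hunit : ∀ z ∈ Metric.ball (0 : ℂ) ρ, z ≠ 1 → IsUnit (arPoly a z))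
    {F : Type*} [NormedAddCommGroup F] [NormedSpace ℂ F] {V : H →L[ℂ] F}
    {g : ℂ → H →L[ℂ] F} (hρ' : 1 < ρ') (hg : DifferentiableOn ℂ g (Metric.ball 0 ρ'))
    (hgA : ∀ z ∈ Metric.ball (0 : ℂ) ρ', (g z).comp (arPoly a z) = (1 - z) ^ b • V)
    (hg1 : g 1 ≠ 0) (hV : V.comp (G 1) = 0) : b < d := by
  by_contra! hdb
  obtain ⟨e, rfl⟩ := Nat.exists_eq_add_of_le hdb
  have hball : ∀ {ρ : ℝ}, 1 < ρ → Metric.ball (0 : ℂ) ρ ∈ 𝓝 (1 : ℂ) := fun h =>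
    Metric.isOpen_ball.mem_nhds (by simpa using h)
  have h1 : Tendsto g (𝓝[≠] (1 : ℂ)) (𝓝 (g 1)) :=
    (hg.differentiableAt (hball hρ')).continuousAt.tendsto.mono_left nhdsWithin_le_nhds
  -- With b = d + e one has g(z) = (1 - z)^e V G(z) off z = 1. As V G(1) = 0, this forces g(1) = 0,
  -- even for e = 0.
  have h2 : Tendsto (fun z : ℂ => (1 - z) ^ e • V.comp (G z)) (𝓝[≠] (1 : ℂ))
      (𝓝 ((1 - 1 : ℂ) ^ e • V.comp (G 1))) := by
    have hc : ContinuousAt (fun z : ℂ => (1 - z) ^ e • V.comp (G z)) 1 :=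
      (by fun_prop : ContinuousAt (fun z : ℂ => (1 - z) ^ e) 1).smul
        (continuousAt_const.clm_comp (hG.differentiableAt (hball hρ)).continuousAt)
    exact hc.tendsto.mono_left nhdsWithin_le_nhds
  rw [hV, smul_zero] at h2
  refine hg1 (tendsto_nhds_unique h1 (h2.congr' ?_))
  filter_upwards [mem_nhdsWithin_of_mem_nhds (hball hρ), mem_nhdsWithin_of_mem_nhds (hball hρ'),
    self_mem_nhdsWithin] with z hz hz' hz1
  have hu := hunit z hz hz1
  have h3 : ∀ T T' : H →L[ℂ] F, T.comp (arPoly a z) = T'.comp (arPoly a z) → T = T' := by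
    intro T T' h
    have h4 := congrArg (fun S : H →L[ℂ] F => S.comp (Ring.inverse (arPoly a z))) h
    simp only [ContinuousLinearMap.comp_assoc] at h4
    have h5 : (arPoly a z).comp (Ring.inverse (arPoly a z)) = ContinuousLinearMap.id ℂ H :=
      Ring.mul_inverse_cancel _ hu
    simpa only [h5, ContinuousLinearMap.comp_id] using h4
  apply h3
  rw [hgA z hz', ContinuousLinearMap.smul_comp, ContinuousLinearMap.comp_assoc, hGA z hz,
    ContinuousLinearMap.comp_smul, ContinuousLinearMap.comp_id, smul_smul, ← pow_add, add_comm]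

end Main
end

/-! ### Proof of the cointegration properties -/

theorem mainTheorem3
    {H : Type*} [NormedAddCommGroup H] [InnerProductSpace ℂ H] [CompleteSpace H]
    [TopologicalSpace.SeparableSpace H] [MeasurableSpace H] [BorelSpace H]
    (hH : ¬ FiniteDimensional ℂ H)
    {Ω : Type*} [MeasurableSpace Ω] (P : Measure Ω) [IsProbabilityMeasure P]
    {k : ℕ} (a : Fin k → H →L[ℂ] H) (ha : HasUnitRootOfFiniteType a)
    (ε x : ℤ → Ω → H) (hε : IsWhiteNoise P ε)
    (hx : IsARSolution P a ε x) (hx' : IsSubexponential P x) :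
    ∃ (d : ℕ) (C : ℕ → H →L[ℂ] H),
      1 ≤ d ∧ IsInverseLaurentExpansion a d C ∧
      IsIntegrated P d x ∧
      FiniteDimensional ℂ (C 0).range ∧
      ¬ FiniteDimensional ℂ ((C 0).range)ᗮ ∧
      ((∀ v : H, v ≠ 0 → 0 < ∫ ω, ‖(inner ℂ v (ε 0 ω) : ℂ)‖ ^ 2 ∂P) →
        IsCointegrated P d x ∧
        attractorSpace P d x = ((C 0).range : Set H) ∧
        cointegratingSpace P d x = (((C 0).range)ᗮ : Submodule ℂ H)) := by
  have : SecondCountableTopology H := UniformSpace.secondCountable_of_separable H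
  obtain ⟨v₀, hv₀, hAv₀⟩ := ha.eigenvalue.exists_eigenvector
  have hid : ContinuousLinearMap.id ℂ H ≠ 0 := fun h =>
    hv₀ (congrArg (fun T : H →L[ℂ] H => T v₀) h)
  obtain ⟨d, G, ρ, hρ, hG, hGA, hunit, hG0⟩ := ha.exists_regularization _ hid
  have h1ball : (1 : ℂ) ∈ Metric.ball (0 : ℂ) ρ := by simpa using hρ
  -- For d = 0 the operator A(1) would have the left inverse G(1).
  have hd : 1 ≤ d := by
    by_contra! h
    obtain rfl : d = 0 := by omega
    have := congrArg (fun T : H →L[ℂ] H => T v₀) (hGA 1 h1ball)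
    simp [hAv₀] at this
    exact hv₀ this.symm
  obtain ⟨C, hC0, hC⟩ := exists_laurentExpansion hρ hG (hG0 1 h1ball) hGA hunit
  have hxint : ∀ t, Integrable (x t) P := fun t => (hx.memLp t).integrable (by norm_num)
  have hIx : IsIntegrated P d x := by
    obtain ⟨φ, hφ, hφG, hφ0, hf, hm⟩ := hx.exists_movingAverage hε.mean_zero hx'
      (ContinuousLinearMap.id ℂ H) hρ hG hGA
    obtain ⟨r, hr, hs⟩ := hφ.exists_summable
    refine ⟨ε, φ, ⟨hε, measurable_diffOp_iterate hx.measurable d,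
      integrable_diffOp_iterate hxint d, hφ0, ⟨r, hr, fun z hz => hs _ (norm_nonneg _) hz⟩,
      fun t => ?_⟩, ?_⟩
    · have hm' := hm t
      simp only [ContinuousLinearMap.id_apply] at hm'
      rw [hm']
      simp only [sub_zero]
      exact hf t
    · have := hφG 1 (by simp)
      simp only [one_pow, one_smul] at this
      rw [this.tsum_eq]
      exact hG0 1 h1ball
  have hfin : FiniteDimensional ℂ (C 0).range := by
    have hle : (C 0).range ≤ (arPoly a 1).ker := by
      rintro _ ⟨w, rfl⟩
      rw [hC0]
      exact congrArg (fun T : H →L[ℂ] H => T w) (arPoly_one_comp_eq_zero hd hρ hG hGA hunit)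
    have := ha.eigenvalue.fredholm.finite_ker
    exact Submodule.finiteDimensional_of_le hle
  have hinf : ¬ FiniteDimensional ℂ ((C 0).range)ᗮ := by
    intro h
    apply hH
    have h1 : (C 0).range ⊔ ((C 0).range)ᗮ = ⊤ :=
      Submodule.sup_orthogonal_of_hasOrthogonalProjection
    have h2 : FiniteDimensional ℂ ((C 0).range ⊔ ((C 0).range)ᗮ : Submodule ℂ H) :=
      Submodule.finiteDimensional_sup _ _
    rw [h1] at h2
    exact Module.finite_def.2 (Module.Finite.iff_fg.1 h2)
  refine ⟨d, C, hd, hC, hIx, hfin, hinf, fun hpos => ?_⟩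
  have hperp : ∀ v : H, v ∈ ((C 0).range)ᗮ ↔ (innerSL ℂ v).comp (G 1) = 0 := by
    intro v
    rw [Submodule.mem_orthogonal', ← hC0]
    constructor
    · intro h
      ext w
      exact h _ ⟨w, rfl⟩
    · rintro h _ ⟨w, rfl⟩
      exact congrArg (fun T : H →L[ℂ] ℂ => T w) h
  have key : ∀ v : H, v ≠ 0 →
      ((∃ b < d, IsIntegrated P b (characteristic v x)) ↔ v ∈ ((C 0).range)ᗮ) := by
    intro v hv
    rw [hperp]
    constructor
    · rintro ⟨b, hb, hbI⟩
      -- The full exponent d is kept, although the pole of ⟨v, A(z)⁻¹ ·⟩ might be smaller: the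
      -- coefficients then sum to ⟨v, C_0 ·⟩, and Δ^d splits into at least one difference after Δ^b.
      obtain ⟨j, rfl⟩ : ∃ j, d = j + 1 + b := ⟨d - 1 - b, by omega⟩
      obtain ⟨φ, hφ, hφG, -, hf, hm⟩ := hx.exists_movingAverage hε.mean_zero hx'
        (innerSL ℂ v) (b := j + 1 + b) (G := fun z => (innerSL ℂ v).comp (G z)) hρ
        ((differentiableOn_const _).clm_comp hG) (fun z hz => by
          rw [ContinuousLinearMap.comp_assoc, hGA z hz, ContinuousLinearMap.comp_smul,
            ContinuousLinearMap.comp_id])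
      have hs := hφG 1 (by simp)
      simp only [one_pow, one_smul] at hs
      rw [Function.iterate_add_apply] at hf hm
      have h0 := hbI.toLpMap_eq_zero hε hφ hf hm hs
      by_contra hne
      exact hε.toLpMap_ne_zero hpos hne h0
    · intro hv0
      have hV : innerSL ℂ v ≠ 0 := fun h => hv (by
        have := congrArg (fun T : H →L[ℂ] ℂ => T v) h
        simpa using this)
      -- Here the exact pole order of the functional is needed, so that g has no zero at z = 1 on
      -- the unit circle.
      obtain ⟨b, g, ρ', hρ', hg, hgA, -, hg0⟩ := ha.exists_regularization (innerSL ℂ v) hV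
      refine ⟨b, regularization_exponent_lt hρ hG hGA hunit hρ' hg hgA
        (hg0 1 (by simpa using hρ')) hv0, ?_⟩
      obtain ⟨φ, hφ, hφg, -, hf, hm⟩ := hx.exists_movingAverage hε.mean_zero hx'
        (innerSL ℂ v) hρ' hg hgA
      exact hε.isIntegratedZero_of_isFilter hpos hφ hφg
        (fun z hz => hg0 z (by simpa [hz] using hρ'))
        (measurable_diffOp_iterate (fun t => (innerSL ℂ v).measurable.comp (hx.measurable t)) b)
        hf hm
  have hcs : cointegratingSpace P d x = (((C 0).range)ᗮ : Submodule ℂ H) := by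
    ext v
    by_cases hv : v = 0
    · simp [cointegratingSpace, hv]
    · simp only [cointegratingSpace, Set.mem_union, Set.mem_ofPred_eq, Set.mem_singleton_iff, hv,
        or_false]
      exact key v hv
  refine ⟨⟨hIx, ?_⟩, ?_, hcs⟩
  · have hne : ((C 0).range)ᗮ ≠ ⊥ := by
      intro h
      apply hinf
      rw [h]
      infer_instance
    obtain ⟨v, hv, hv0⟩ := Submodule.exists_mem_ne_zero_of_ne_bot hne
    exact ⟨v, hv0, (key v hv0).2 hv⟩
  · have h1 : attractorSpace P d x = (((C 0).range)ᗮᗮ : Submodule ℂ H) := by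
      ext u
      rw [attractorSpace, hcs, SetLike.mem_coe, Submodule.mem_orthogonal]
      rfl
    rw [h1, Submodule.orthogonal_orthogonal]
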